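/- For $X\in\mathbb R^{d\times d}$ let $\mathrm{BN}(X)_{ij}=X_{ij}/\sqrt{\sum_k X_{ik}^2}$ (batch normalisation of each row, without mean reduction), and let $$\phi(X)=-\log\frac{\det(X^\top X)^{1/d}}{\frac1d\operatorname{tr}(X^\top X)}$$ be the isometry gap. Let $\|\cdot\|$ denote the Frobenius norm of matrices. For every $K\ge 0$ there is a constant $C=C(K)$, depending on nothing else, such that the following holds. Let $d\ge1$, let $X_0\in\mathbb R^{d\times d}$ be non-degenerate ($\det X_0\neq0$), let $W_0,W_1,\dots$ be independent random matrices distributed according to the Haar probability measure on the orthogonal group $O(d)$, and let $X_{k+1}=\mathrm{BN}(W_kX_k)$ for $k\ge0$. Let $\mathcal L:\mathbb R^{d\times d}\to\mathbb R$ be $K$-Lipschitz with respect to $\|\cdot\|$. Let $0\le\ell\le L$, and let $\nabla_{W_\ell}\mathcal L(X_{L+1})$ be the gradient of the loss at the network output $X_{L+1}$, as a function of the $d^2$ unconstrained entries of $W_\ell$ with all other weights fixed, evaluated at the random weights. Then almost surely this gradient exists if $\mathcal L$ is differentiable at $X_{L+1}$ (where it does not exist it is read as $0$), and, with $\log 0=-\infty$,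 the expectation of $\log\|\nabla_{W_\ell}\mathcal L(X_{L+1})\|$ over the weights is well defined in $[-\infty,\infty)$ and $$\mathbb E\big[\log\|\nabla_{W_\ell}\mathcal L(X_{L+1})\|\big]\le C\,d^5\big(\phi(X_0)^3+1\big).$$ The bound does not depend on the depth $L$. If moreover $L\ge1$, then also $$\mathbb E\big[\log\|\nabla_{W_\ell}\mathcal L(X_{L+1})\|\big]\le C\,d^5\Big(\phi(X_0)^3+1-e^{-L/(32d^4)}\Big).$$ For $L\ge1$ all these assertions also hold when the loss is evaluated at the logits $W_LX_L$ instead of at $X_{L+1}$. -/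

import Mathlib

open MeasureTheory ProbabilityTheory
open scoped NNReal ENNReal

namespace OrthoBN

/-- Square real matrices of size `d`; rows are features, columns are the `n = d` samples. -/
abbrev Mat (d : ℕ) : Type := Matrix (Fin d) (Fin d) ℝ

/-- The orthogonal group `O(d)`: real matrices `W` with `W * Wᵀ = 1`
(over `ℝ` the star operation on matrices is the transpose). -/
abbrev Orth (d : ℕ) : Type := Matrix.unitaryGroup (Fin d) ℝ

instance instCompactSpaceOrth (d : ℕ) : CompactSpace (Orth d) := by
  have hc : IsClosed ((Matrix.unitaryGroup (Fin d) ℝ : Submonoid (Mat d)) : Set (Mat d)) :=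
    isClosed_unitary
  have hK : IsCompact {A : Mat d | ∀ i, A i ∈ {v : Fin d → ℝ | ∀ j, v j ∈ Set.Icc (-1 : ℝ) 1}} :=
    isCompact_pi_infinite fun _ => isCompact_pi_infinite fun _ => isCompact_Icc
  refine isCompact_iff_compactSpace.mp (hK.of_isClosed_subset hc ?_)
  intro A hA i j
  have h := entry_norm_bound_of_unitary (𝕜 := ℝ) hA i j
  rw [Real.norm_eq_abs, abs_le] at h
  exact h

instance instMeasurableSpaceOrth (d : ℕ) : MeasurableSpace (Orth d) := borel _

instance instBorelSpaceOrth (d : ℕ) : BorelSpace (Orth d) := ⟨rfl⟩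

/-- The Haar probability measure on `O(d)`. -/
noncomputable def haarOrth (d : ℕ) : Measure (Orth d) := Measure.haarMeasure ⊤

/-- Batch normalisation without mean reduction: every row is divided by its Euclidean norm. -/
noncomputable def bn {d : ℕ} (X : Mat d) : Mat d :=
  Matrix.of fun i j => X i j / Real.sqrt (∑ k, X i k ^ 2)

/-- The hidden representations `X_{ℓ+1} = BN (W_ℓ X_ℓ)` of the linear MLP. -/
noncomputable def rep {d : ℕ} (W : ℕ → Mat d) (X₀ : Mat d) : ℕ → Mat d
  | 0 => X₀
  | ℓ + 1 => bn (W ℓ * rep W X₀ ℓ)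

/-- The (unnormalised) logits `H_L = W_L X_L`. -/
noncomputable def logits {d : ℕ} (W : ℕ → Mat d) (X₀ : Mat d) (L : ℕ) : Mat d := W L * rep W X₀ L

/-- The isometry gap `φ(X) = -log (det(Xᵀ X)^(1/d) / ((1/d) tr(Xᵀ X)))`. -/
noncomputable def isoGap {d : ℕ} (X : Mat d) : ℝ :=
  -Real.log ((X.transpose * X).det ^ (1 / (d : ℝ)) / (1 / (d : ℝ) * (X.transpose * X).trace))

/-- The function `F` of all the weights, as a function of the `ℓ`-th weight matrix alone. -/
noncomputable def inWeight {d : ℕ} (F : (ℕ → Mat d) → ℝ) (W : ℕ → Mat d) (ℓ : ℕ) : Mat d → ℝ :=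
  fun A => F (Function.update W ℓ A)

end OrthoBN

-- Norms of matrices (hence Lipschitz constants and gradient norms) are Frobenius norms.
attribute [local instance] Matrix.frobeniusNormedAddCommGroup Matrix.frobeniusNormedSpace

namespace OrthoBN

/-- The gradient `∇_{W_ℓ} F`: the matrix of the partial derivatives of `F` in the (unconstrained)
entries of the `ℓ`-th weight matrix; it is zero where the derivative does not exist. -/
noncomputable def weightGrad {d : ℕ} (F : (ℕ → Mat d) → ℝ) (W : ℕ → Mat d) (ℓ : ℕ) : Mat d :=
  Matrix.of fun i j => fderiv ℝ (inWeight F W ℓ) (W ℓ) (Matrix.single i j 1)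

/-- The expectation of an extended real random variable, `E[f⁺] - E[f⁻]`, meaningful as soon as
`E[f⁺]` or `E[f⁻]` is finite. -/
noncomputable def extExp {Ω : Type*} [MeasurableSpace Ω] (P : Measure Ω) (f : Ω → EReal) : EReal :=
  ((∫⁻ ω, (f ω).toENNReal ∂P : ℝ≥0∞) : EReal) - ((∫⁻ ω, (-f ω).toENNReal ∂P : ℝ≥0∞) : EReal)

/-- The expectation `E[log ‖∇_{W_ℓ} F‖]` over the random weights `W` (with `log 0 = -∞`) is well
defined in `[-∞, ∞)` and at most `B`. -/
def ExpLogGradLE {d : ℕ} {Ω : Type*} [MeasurableSpace Ω] (P : Measure Ω) (W : ℕ → Ω → Orth d)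
    (F : (ℕ → Mat d) → ℝ) (ℓ : ℕ) (B : ℝ) : Prop :=
  (∫⁻ ω, (ENNReal.log ‖weightGrad F (fun k => (W k ω : Mat d)) ℓ‖ₑ).toENNReal ∂P) < ∞ ∧
    extExp P (fun ω => ENNReal.log ‖weightGrad F (fun k => (W k ω : Mat d)) ℓ‖ₑ) ≤ (B : EReal)

end OrthoBN

/-!
Write `H = W_k X_k` for the preactivation of layer `k`, `y_i` for the squared lengths of the rows of
`H` divided by their average (`rowEnergy`), and `t_k = d (φ(X_k) - φ(X_{k+1}))` for the drop of the
isometry gap (`gapDrop`).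

**Deterministic part.** Normalising the rows divides the determinant by the product of their
lengths, so `t_k = -∑ log y_i`, and since the `y_i` have average `1`, also
`t_k = ∑ (y_i - 1 - log y_i)`, a sum of nonnegative terms (`gapDrop_eq_sum`). Hence the isometry gap
never increases, and no row is short unless the gap drops: `-log y_i ≤ t_k + √(2 t_k)`
(`neg_log_le`). The derivative of the normalisation of a row of length `r` has norm at most `1 / r`,
so by the chain rule (`slopeLE_rep`, `slopeLE_logits`) the logarithm of the gradient norm is at most
`log K + log √d + ½ ∑ (t_k + √(2 t_k))`. Here `∑ t_k ≤ d φ(X₀)` telescopes. The chain rule is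
applied to pointwise Lipschitz constants (`SlopeLE`), so that the bound is valid also where the loss
is not differentiable.

**Probabilistic part.** It remains to bound `E ∑ √(2 t_k)` independently of the depth. The numbers
`y_i - 1` are the diagonal entries of `W A Wᵀ` with `A = (d / ‖X‖²) X Xᵀ - 1`. By invariance of the
Haar measure under reflections in coordinate planes the diagonal carries at least the fraction `1/d`
of `‖A‖²` on average (`norm_sq_le_integral_diag`), and in terms of the eigenvalues of `X Xᵀ` one
sees that `4 ‖A‖² ≥ min φ(X) 1` (`min_isoGap_le`). So the mean of `t_k`, given `X_k`, is at least
`min φ(X_k) 1 / (16 d²)` (`min_isoGap_le_integral`), and `18 d² (√φ + φ)` is a Lyapunov function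
whose expected decrease in a layer is at least the mean of `√(2 t_k)` (`integral_sqrt_gapDrop_le`).
As `W_k` is independent of `X_k`, summation gives `E ∑ √(2 t_k) ≤ 18 d² (√φ(X₀) + φ(X₀))`
(`sum_lintegral_sqrt_gapDrop_le`).

This is the bound independent of the depth. The second bound follows from it if `L ≥ 32 d⁴`, and
otherwise from `√(2 t_k) ≤ t_k + 1`, which gives the sure bound
`K + d + d φ(X₀) + L + 1` (`logGradBound_le`, `depth_bound_le`).
-/

open Filter Topology

namespace OrthoBN

/-! ### Frobenius norms and pointwise Lipschitz constants -/

theorem frobenius_norm_sq {d : ℕ} (A : Mat d) : ‖A‖ ^ 2 = ∑ i, ∑ j, A i j ^ 2 := by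
  have h : 0 ≤ ∑ i, ∑ j, ‖A i j‖ ^ (2 : ℝ) := by positivity
  rw [Matrix.frobenius_norm_def, ← Real.rpow_natCast, ← Real.rpow_mul h]
  norm_num

theorem frobenius_norm_sq_eq_trace {d : ℕ} (A : Mat d) :
    ‖A‖ ^ 2 = (A.transpose * A).trace := by
  rw [frobenius_norm_sq, Finset.sum_comm]
  simp [Matrix.trace, Matrix.mul_apply, sq]

theorem transpose_mul_self_of_mem {d : ℕ} {W : Mat d} (hW : W ∈ Matrix.unitaryGroup (Fin d) ℝ) :
    W.transpose * W = 1 := by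
  have := Matrix.mem_unitaryGroup_iff'.1 hW
  rwa [Matrix.star_eq_conjTranspose, Matrix.conjTranspose_eq_transpose_of_trivial] at this

theorem norm_orthogonal_mul {d : ℕ} {W : Mat d} (hW : W ∈ Matrix.unitaryGroup (Fin d) ℝ)
    (A : Mat d) : ‖W * A‖ = ‖A‖ := by
  have h : ‖W * A‖ ^ 2 = ‖A‖ ^ 2 := by
    rw [frobenius_norm_sq_eq_trace, frobenius_norm_sq_eq_trace, Matrix.transpose_mul,
      Matrix.mul_assoc, ← Matrix.mul_assoc W.transpose, transpose_mul_self_of_mem hW,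
      Matrix.one_mul]
  exact (pow_left_inj₀ (norm_nonneg _) (norm_nonneg _) two_ne_zero).1 h

/-- The pointwise Lipschitz constant (`limsup` of the difference quotients) of `f` at `x` is at
most `c`. Unlike a bound for the derivative it makes sense, and obeys the chain rule, for maps that
are not differentiable. -/
def SlopeLE {E F : Type*} [NormedAddCommGroup E] [NormedAddCommGroup F] (f : E → F) (x : E)
    (c : ℝ) : Prop :=
  ∀ c' > c, ∀ᶠ y in 𝓝 x, ‖f y - f x‖ ≤ c' * ‖y - x‖

theorem SlopeLE.of_le {E F : Type*} [NormedAddCommGroup E] [NormedAddCommGroup F] {f : E → F}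
    {x : E} {c : ℝ} (h : ∀ y, ‖f y - f x‖ ≤ c * ‖y - x‖) : SlopeLE f x c := fun c' hc' =>
  Eventually.of_forall fun y => (h y).trans (by gcongr)

theorem SlopeLE.comp {E F G : Type*} [NormedAddCommGroup E] [NormedAddCommGroup F]
    [NormedAddCommGroup G] {g : F → G} {f : E → F} {x : E} {b c : ℝ} (hb : 0 ≤ b)
    (hg : SlopeLE g (f x) b) (hf : SlopeLE f x c) (hfc : ContinuousAt f x) :
    SlopeLE (fun y => g (f y)) x (b * c) := by
  intro e he
  have hev : ∀ᶠ δ : ℝ in 𝓝[>] 0, (b + δ) * (c + δ) < e := by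
    have ht : Tendsto (fun δ : ℝ => (b + δ) * (c + δ)) (𝓝[>] 0) (𝓝 ((b + 0) * (c + 0))) :=
      (Continuous.tendsto (by fun_prop) 0).mono_left nhdsWithin_le_nhds
    exact ht.eventually_lt_const (by simpa using he)
  obtain ⟨δ, hδ, hδ0⟩ := (hev.and self_mem_nhdsWithin).exists
  have hδ0 : 0 < δ := hδ0
  filter_upwards [hf (c + δ) (by linarith), hfc.eventually (hg (b + δ) (by linarith))] with y h1 h2
  calc ‖g (f y) - g (f x)‖ ≤ (b + δ) * ‖f y - f x‖ := h2
    _ ≤ (b + δ) * ((c + δ) * ‖y - x‖) := by gcongr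
    _ = ((b + δ) * (c + δ)) * ‖y - x‖ := by ring
    _ ≤ e * ‖y - x‖ := by gcongr

/-- Whether or not `f` is differentiable, the matrix of its partial derivatives is bounded by its
pointwise Lipschitz constant. -/
theorem norm_of_fderiv_single_le {d : ℕ} {f : Mat d → ℝ} {x : Mat d} {c : ℝ} (hc : 0 ≤ c)
    (hf : SlopeLE f x c) :
    ‖(Matrix.of fun i j => fderiv ℝ f x (Matrix.single i j 1) : Mat d)‖ ≤ c := by
  refine le_of_forall_gt_imp_ge_of_dense fun e he => ?_
  have hn := norm_fderiv_le_of_lip' ℝ (hc.trans he.le) (hf e he)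
  have hv : ∀ v : Mat d, fderiv ℝ f x v ≤ e * ‖v‖ := fun v =>
    (le_abs_self _).trans (ContinuousLinearMap.le_of_opNorm_le _ hn v)
  set g : Mat d := Matrix.of fun i j => fderiv ℝ f x (Matrix.single i j 1) with hg
  -- the derivative in the direction of the gradient is the square of its norm
  have hgg : fderiv ℝ f x g = ‖g‖ ^ 2 := by
    have h1 : g = ∑ i, ∑ j, g i j • Matrix.single i j (1 : ℝ) := by
      conv_lhs => rw [Matrix.matrix_eq_sum_single g]
      simp [Matrix.smul_single]
    conv_lhs => rw [h1]
    rw [frobenius_norm_sq]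
    simp only [map_sum, map_smul, smul_eq_mul]
    refine Finset.sum_congr rfl fun i _ => Finset.sum_congr rfl fun j _ => ?_
    rw [sq]; rfl
  have := hv g
  rw [hgg, sq] at this
  rcases (norm_nonneg g).eq_or_lt with h0 | h0
  · rw [← h0]; exact hc.trans he.le
  · exact le_of_mul_le_mul_right this h0

theorem differentiableAt_mat {d : ℕ} {f : Mat d → Mat d} {x : Mat d}
    (h : ∀ i j, DifferentiableAt ℝ (fun X => f X i j) x) : DifferentiableAt ℝ f x := by
  have h1 : ∀ i, DifferentiableAt ℝ (fun X => (f X i : Fin d → ℝ)) x :=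
    fun i => differentiableAt_pi.2 (h i)
  exact (differentiableAt_pi (F' := fun _ : Fin d => Fin d → ℝ)
    (Φ := fun X => (f X : Fin d → Fin d → ℝ))).2 h1

/-! ### The derivative of batch normalisation -/

/-- Normalisation divides distances at least by the geometric mean of the two lengths. In contrast
to the triangle inequality this gives the sharp constant `1 / ‖u‖` as `v` tends to `u`. -/
theorem norm_normalize_sub_sq_le {E : Type*} [NormedAddCommGroup E] [InnerProductSpace ℝ E]
    {u v : E} (hu : u ≠ 0) (hv : v ≠ 0) :
    ‖‖u‖⁻¹ • u - ‖v‖⁻¹ • v‖ ^ 2 ≤ ‖u - v‖ ^ 2 / (‖u‖ * ‖v‖) := by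
  have hu' : 0 < ‖u‖ := norm_pos_iff.2 hu
  have hv' : 0 < ‖v‖ := norm_pos_iff.2 hv
  rw [norm_sub_sq_real, norm_sub_sq_real, norm_smul, norm_smul, real_inner_smul_left,
    real_inner_smul_right, norm_inv, norm_inv, norm_norm, norm_norm, le_div_iff₀ (by positivity)]
  have : (((‖u‖⁻¹ * ‖u‖) ^ 2 - 2 * (‖u‖⁻¹ * (‖v‖⁻¹ * inner ℝ u v)) + (‖v‖⁻¹ * ‖v‖) ^ 2) *
      (‖u‖ * ‖v‖)) = 2 * (‖u‖ * ‖v‖) - 2 * inner ℝ u v := by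
    field_simp; ring
  rw [this]
  nlinarith [sq_nonneg (‖u‖ - ‖v‖)]

theorem norm_bn_row_sub_sq_le {d : ℕ} {H H' : Mat d} {i : Fin d} (h : 0 < ∑ k, H i k ^ 2)
    (h' : 0 < ∑ k, H' i k ^ 2) :
    ∑ j, (bn H' i j - bn H i j) ^ 2 ≤ (∑ j, (H' i j - H i j) ^ 2) /
      (√(∑ k, H' i k ^ 2) * √(∑ k, H i k ^ 2)) := by
  have hn : ∀ A : Mat d, ‖WithLp.toLp 2 (A i)‖ = √(∑ k, A i k ^ 2) := fun A => by
    rw [EuclideanSpace.norm_eq]; simp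
  have hz : ∀ A : Mat d, 0 < ∑ k, A i k ^ 2 → WithLp.toLp 2 (A i) ≠ 0 := fun A hA => by
    rw [← norm_pos_iff, hn]; exact Real.sqrt_pos.2 hA
  have := norm_normalize_sub_sq_le (hz H' h') (hz H h)
  rw [hn, hn, EuclideanSpace.norm_sq_eq, EuclideanSpace.norm_sq_eq] at this
  simpa [bn, div_eq_inv_mul] using this

theorem slopeLE_bn {d : ℕ} {H : Mat d} {b : ℝ} (hb : 0 < b) (hH : ∀ i, b ^ 2 ≤ ∑ k, H i k ^ 2) :
    SlopeLE bn H (1 / b) := by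
  intro c hc
  have hc0 : 0 < c := lt_trans (by positivity) hc
  have hcb : 1 / c < b := by
    rw [div_lt_iff₀ hc0, mul_comm]; rwa [gt_iff_lt, div_lt_iff₀ hb] at hc
  have hr : ∀ i, b ≤ √(∑ k, H i k ^ 2) := fun i => Real.le_sqrt_of_sq_le (hH i)
  have hpos : ∀ i, 0 < ∑ k, H i k ^ 2 := fun i => lt_of_lt_of_le (by positivity) (hH i)
  have hev : ∀ᶠ H' in 𝓝 H, ∀ i, 1 / c ^ 2 < √(∑ k, H' i k ^ 2) * √(∑ k, H i k ^ 2) ∧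
      0 < ∑ k, H' i k ^ 2 := by
    rw [eventually_all]
    intro i
    have hcont : Continuous fun H' : Mat d => ∑ k, H' i k ^ 2 := by fun_prop
    have hcont2 : Continuous fun H' : Mat d => √(∑ k, H' i k ^ 2) * √(∑ k, H i k ^ 2) := by
      fun_prop
    refine (hcont2.continuousAt.eventually_const_lt ?_).and
      (hcont.continuousAt.eventually_const_lt (hpos i))
    have : 1 / c ^ 2 = (1 / c) * (1 / c) := by ring
    rw [this]
    exact mul_lt_mul'' (hcb.trans_le (hr i)) (hcb.trans_le (hr i)) (by positivity) (by positivity)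
  filter_upwards [hev] with H' h'
  refine abs_le_of_sq_le_sq' ?_ (by positivity) |>.2
  rw [mul_pow, frobenius_norm_sq, frobenius_norm_sq, Finset.mul_sum]
  refine Finset.sum_le_sum fun i _ => ?_
  refine (norm_bn_row_sub_sq_le (hpos i) (h' i).2).trans ?_
  have h0 : (0:ℝ) ≤ ∑ j, (H' i j - H i j) ^ 2 := by positivity
  have h1 := (h' i).1
  rw [div_le_iff₀ (lt_trans (by positivity) h1)]
  rw [div_lt_iff₀ (by positivity)] at h1
  simp only [Matrix.sub_apply]
  nlinarith

theorem differentiableAt_bn {d : ℕ} {H : Mat d} (hH : ∀ i, 0 < ∑ k, H i k ^ 2) :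
    DifferentiableAt ℝ bn H := by
  refine differentiableAt_mat fun i j => ?_
  have h1 : ∀ k, DifferentiableAt ℝ (fun X : Mat d => X i k) H := fun k => by fun_prop
  have h2 : DifferentiableAt ℝ (fun X : Mat d => ∑ k, X i k ^ 2) H := by fun_prop
  have h3 : DifferentiableAt ℝ (fun X : Mat d => √(∑ k, X i k ^ 2)) H := h2.sqrt (hH i).ne'
  have h4 : DifferentiableAt ℝ (fun X : Mat d => (√(∑ k, X i k ^ 2))⁻¹) H :=
    h3.fun_inv (Real.sqrt_pos.2 (hH i)).ne'
  simp only [bn, Matrix.of_apply, div_eq_mul_inv]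
  exact (h1 j).fun_mul h4

theorem bn_row_sq {d : ℕ} {H : Mat d} {i : Fin d} (hH : 0 < ∑ k, H i k ^ 2) :
    ∑ j, bn H i j ^ 2 = 1 := by
  simp only [bn, Matrix.of_apply, div_pow, Real.sq_sqrt hH.le, ← Finset.sum_div]
  exact div_self hH.ne'

theorem norm_bn_sq {d : ℕ} {H : Mat d} (hH : ∀ i, 0 < ∑ k, H i k ^ 2) : ‖bn H‖ ^ 2 = d := by
  rw [frobenius_norm_sq, Finset.sum_congr rfl fun i _ => bn_row_sq (hH i)]
  simp

/-! ### The derivative of the network in one of its weights -/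

theorem slopeLE_mul_right {d : ℕ} (X W : Mat d) : SlopeLE (fun A : Mat d => A * X) W ‖X‖ :=
  SlopeLE.of_le fun A => by
    rw [← Matrix.sub_mul, mul_comm]; exact Matrix.frobenius_norm_mul _ _

theorem slopeLE_mul_left {d : ℕ} {W : Mat d} (hW : W ∈ Matrix.unitaryGroup (Fin d) ℝ) (X : Mat d) :
    SlopeLE (fun A : Mat d => W * A) X 1 :=
  SlopeLE.of_le fun A => by rw [← Matrix.mul_sub, norm_orthogonal_mul hW, one_mul]

theorem differentiableAt_mul_right {d : ℕ} (X W : Mat d) :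
    DifferentiableAt ℝ (fun A : Mat d => A * X) W :=
  differentiableAt_mat fun i j => by simp only [Matrix.mul_apply]; fun_prop

theorem differentiableAt_mul_left {d : ℕ} (W X : Mat d) :
    DifferentiableAt ℝ (fun A : Mat d => W * A) X :=
  differentiableAt_mat fun i j => by simp only [Matrix.mul_apply]; fun_prop

theorem rep_update_of_le {d : ℕ} (W : ℕ → Mat d) (X₀ : Mat d) {ℓ n : ℕ} (hn : n ≤ ℓ) (A : Mat d) :
    rep (Function.update W ℓ A) X₀ n = rep W X₀ n := by
  induction n with
  | zero => rfl
  | succ n ih =>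
    rw [rep, rep, ih (by omega), Function.update_of_ne (by omega)]

/-- The effect of the chain rule. If in each layer `k` every row of `W_k X_k` has at least `c_k⁻²`
times the average squared row length `‖X_k‖² / d`, then the layer amplifies perturbations by at most
`c_k`; the layer in which the weight sits contributes an additional `√d`. -/
theorem slopeLE_rep {d : ℕ} (hd : 0 < d) {W : ℕ → Mat d} {X₀ : Mat d} {c : ℕ → ℝ}
    (hW : ∀ k, W k ∈ Matrix.unitaryGroup (Fin d) ℝ) (hc : ∀ k, 0 < c k)
    (hX : ∀ k, rep W X₀ k ≠ 0)
    (hrow : ∀ k i, ‖rep W X₀ k‖ ^ 2 / d ≤ c k ^ 2 * ∑ j, (W k * rep W X₀ k) i j ^ 2)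
    (ℓ n : ℕ) (hn : ℓ < n) :
    SlopeLE (fun A => rep (Function.update W ℓ A) X₀ n) (W ℓ)
        (√d * ∏ k ∈ Finset.Ico ℓ n, c k) ∧
      DifferentiableAt ℝ (fun A => rep (Function.update W ℓ A) X₀ n) (W ℓ) := by
  have hd' : (0 : ℝ) < d := by exact_mod_cast hd
  have hXp : ∀ k, 0 < ‖rep W X₀ k‖ := fun k => norm_pos_iff.2 (hX k)
  have hb : ∀ k i, (‖rep W X₀ k‖ / (√d * c k)) ^ 2 ≤ ∑ j, (W k * rep W X₀ k) i j ^ 2 := by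
    intro k i
    have := hc k
    rw [div_pow, mul_pow, Real.sq_sqrt hd'.le, ← div_div, div_le_iff₀ (by positivity),
      mul_comm _ (c k ^ 2)]
    exact hrow k i
  have hbp : ∀ k, 0 < ‖rep W X₀ k‖ / (√d * c k) := fun k => by
    have := hc k
    have := hXp k
    positivity
  have hpos : ∀ k i, 0 < ∑ j, (W k * rep W X₀ k) i j ^ 2 := fun k i =>
    lt_of_lt_of_le (pow_pos (hbp k) 2) (hb k i)
  induction n, Nat.succ_le_of_lt hn using Nat.le_induction with
  | base =>
    have he : (fun A => rep (Function.update W ℓ A) X₀ (ℓ + 1)) =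
        fun A => bn (A * rep W X₀ ℓ) := by
      funext A
      rw [rep, rep_update_of_le W X₀ le_rfl, Function.update_self]
    rw [he]
    have hdm := differentiableAt_mul_right (rep W X₀ ℓ) (W ℓ)
    have hs := (slopeLE_bn (hbp ℓ) (hb ℓ))
    refine ⟨?_, DifferentiableAt.comp (g := bn) (W ℓ) (differentiableAt_bn (hpos ℓ)) hdm⟩
    have := SlopeLE.comp (f := fun A : Mat d => A * rep W X₀ ℓ) (by have := hbp ℓ; positivity) hs
      (slopeLE_mul_right (rep W X₀ ℓ) (W ℓ)) hdm.continuousAt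
    have hXℓ := hXp ℓ
    have hcℓ := hc ℓ
    have hconst : 1 / (‖rep W X₀ ℓ‖ / (√d * c ℓ)) * ‖rep W X₀ ℓ‖ =
        √d * ∏ k ∈ Finset.Ico ℓ (ℓ + 1), c k := by
      rw [Nat.Ico_succ_singleton, Finset.prod_singleton]
      field_simp
    rwa [hconst] at this
  | succ n hle ih =>
    obtain ⟨ih1, ih2⟩ := ih (by omega)
    have he : (fun A => rep (Function.update W ℓ A) X₀ (n + 1)) =
        fun A => bn (W n * rep (Function.update W ℓ A) X₀ n) := by
      funext A
      rw [rep, Function.update_of_ne (by omega)]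
    rw [he]
    have hself : rep (Function.update W ℓ (W ℓ)) X₀ n = rep W X₀ n := by
      rw [Function.update_eq_self]
    have hdm : DifferentiableAt ℝ (fun A => W n * rep (Function.update W ℓ A) X₀ n) (W ℓ) :=
      (differentiableAt_mul_left (W n) _).comp _ ih2
    have hs1 : SlopeLE (fun A => W n * rep (Function.update W ℓ A) X₀ n) (W ℓ) (1 * _) :=
      SlopeLE.comp zero_le_one (slopeLE_mul_left (hW n) _) ih1 ih2.continuousAt
    -- the input of the layer is normalised already
    have hnorm : ‖rep W X₀ n‖ = √d := by
      obtain ⟨m, rfl⟩ : ∃ m, n = m + 1 := ⟨n - 1, by omega⟩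
      rw [← norm_bn_sq (hpos m), Real.sqrt_sq (norm_nonneg _)]; rfl
    have hcn := hc n
    have hbn : SlopeLE bn (W n * rep (Function.update W ℓ (W ℓ)) X₀ n) (c n) := by
      rw [hself]
      have := slopeLE_bn (hbp n) (hb n)
      rw [hnorm] at this
      convert this using 1
      have : √(d : ℝ) ≠ 0 := (Real.sqrt_pos.2 hd').ne'
      field_simp
    refine ⟨?_, DifferentiableAt.comp (g := bn) (W ℓ) ?_ hdm⟩
    · have := SlopeLE.comp (f := fun A => W n * rep (Function.update W ℓ A) X₀ n) hcn.le hbn hs1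
        hdm.continuousAt
      convert this using 1
      rw [Finset.prod_Ico_succ_top (by omega)]
      ring
    · rw [hself]; exact differentiableAt_bn (hpos n)

theorem slopeLE_of_lipschitzWith {d : ℕ} {K : ℝ≥0} {f : Mat d → ℝ} (hf : LipschitzWith K f)
    (x : Mat d) : SlopeLE f x K :=
  SlopeLE.of_le fun y => by
    have := hf.dist_le_mul y x
    rwa [dist_eq_norm, dist_eq_norm] at this

theorem slopeLE_logits {d : ℕ} (hd : 0 < d) {W : ℕ → Mat d} {X₀ : Mat d} {c : ℕ → ℝ}
    (hW : ∀ k, W k ∈ Matrix.unitaryGroup (Fin d) ℝ) (hc : ∀ k, 0 < c k)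
    (hX : ∀ k, rep W X₀ k ≠ 0) (hXn : ∀ k, ‖rep W X₀ (k + 1)‖ ^ 2 = d)
    (hrow : ∀ k i, ‖rep W X₀ k‖ ^ 2 / d ≤ c k ^ 2 * ∑ j, (W k * rep W X₀ k) i j ^ 2)
    (ℓ L : ℕ) (hℓ : ℓ ≤ L) (hL : 1 ≤ L) :
    SlopeLE (fun A => logits (Function.update W ℓ A) X₀ L) (W ℓ)
        (√d * ∏ k ∈ Finset.Ico ℓ L, c k) ∧
      DifferentiableAt ℝ (fun A => logits (Function.update W ℓ A) X₀ L) (W ℓ) := by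
  rcases hℓ.eq_or_lt with rfl | hlt
  · have he : (fun A => logits (Function.update W ℓ A) X₀ ℓ) = fun A => A * rep W X₀ ℓ := by
      funext A
      rw [logits, rep_update_of_le W X₀ le_rfl, Function.update_self]
    rw [he]
    refine ⟨?_, differentiableAt_mul_right _ _⟩
    have := slopeLE_mul_right (rep W X₀ ℓ) (W ℓ)
    obtain ⟨m, rfl⟩ : ∃ m, ℓ = m + 1 := ⟨ℓ - 1, by omega⟩
    rwa [← Real.sqrt_sq (norm_nonneg (rep W X₀ (m + 1))), hXn, ← mul_one √(d : ℝ),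
      ← Finset.prod_empty (f := c), ← Finset.Ico_self (m + 1)] at this
  · obtain ⟨h1, h2⟩ := slopeLE_rep hd hW hc hX hrow ℓ L hlt
    have he : (fun A => logits (Function.update W ℓ A) X₀ L) =
        fun A => W L * rep (Function.update W ℓ A) X₀ L := by
      funext A
      rw [logits, Function.update_of_ne (by omega)]
    rw [he]
    refine ⟨?_, (differentiableAt_mul_left (W L) _).comp _ h2⟩
    have := SlopeLE.comp zero_le_one (slopeLE_mul_left (hW L) _) h1 h2.continuousAt
    rwa [one_mul] at this

/-! ### Decrease of the isometry gap in one layer -/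

/-- The squared length of the `i`-th row of `H`, relative to the average over all rows. -/
noncomputable def rowEnergy {d : ℕ} (H : Mat d) (i : Fin d) : ℝ :=
  d * (∑ j, H i j ^ 2) / ‖H‖ ^ 2

/-- The amount `d (φ(H) - φ(BN(H)))` by which batch normalisation decreases `d` times the isometry
gap. -/
noncomputable def gapDrop {d : ℕ} (H : Mat d) : ℝ := d * (isoGap H - isoGap (bn H))

theorem row_sq_pos {d : ℕ} {H : Mat d} (hH : H.det ≠ 0) (i : Fin d) : 0 < ∑ j, H i j ^ 2 := by
  refine lt_of_le_of_ne (by positivity) fun h => hH ?_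
  refine Matrix.det_eq_zero_of_row_eq_zero i fun j => ?_
  have := (Finset.sum_eq_zero_iff_of_nonneg fun j _ => sq_nonneg (H i j)).1 h.symm j
    (Finset.mem_univ j)
  exact pow_eq_zero_iff two_ne_zero |>.1 this

theorem norm_pos_of_det_ne_zero {d : ℕ} (hd : 0 < d) {H : Mat d} (hH : H.det ≠ 0) : 0 < ‖H‖ := by
  refine norm_pos_iff.2 fun h => hH ?_
  have : Nonempty (Fin d) := ⟨⟨0, hd⟩⟩
  rw [h, Matrix.det_zero]

theorem mul_isoGap {d : ℕ} (hd : 0 < d) {H : Mat d} (hH : H.det ≠ 0) :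
    d * isoGap H = d * Real.log (‖H‖ ^ 2 / d) - Real.log (H.det ^ 2) := by
  have hd' : (0 : ℝ) < d := by exact_mod_cast hd
  have hn := norm_pos_of_det_ne_zero hd hH
  have hdet : (H.transpose * H).det = H.det ^ 2 := by
    rw [Matrix.det_mul, Matrix.det_transpose, sq]
  have hp : 0 < H.det ^ 2 := by positivity
  rw [isoGap, ← frobenius_norm_sq_eq_trace, hdet, Real.log_div (by positivity) (by positivity),
    Real.log_rpow hp, one_div_mul_eq_div]
  field_simp
  ring

theorem isoGap_orthogonal_mul {d : ℕ} {W : Mat d} (hW : W ∈ Matrix.unitaryGroup (Fin d) ℝ)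
    (X : Mat d) : isoGap (W * X) = isoGap X := by
  have : (W * X).transpose * (W * X) = X.transpose * X := by
    rw [Matrix.transpose_mul, Matrix.mul_assoc, ← Matrix.mul_assoc W.transpose,
      transpose_mul_self_of_mem hW, Matrix.one_mul]
  rw [isoGap, isoGap, this]

theorem det_orthogonal_mul_ne_zero {d : ℕ} {W : Mat d} (hW : W ∈ Matrix.unitaryGroup (Fin d) ℝ)
    {X : Mat d} (hX : X.det ≠ 0) : (W * X).det ≠ 0 := by
  rw [Matrix.det_mul]
  refine mul_ne_zero (fun h => ?_) hX
  have := congrArg Matrix.det (transpose_mul_self_of_mem hW)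
  rw [Matrix.det_mul, h, mul_zero, Matrix.det_one] at this
  exact zero_ne_one this

theorem det_bn {d : ℕ} (H : Mat d) : (bn H).det = (∏ i, (√(∑ k, H i k ^ 2))⁻¹) * H.det := by
  rw [← Matrix.det_diagonal, ← Matrix.det_mul]
  congr 1
  ext i j
  rw [Matrix.diagonal_mul, bn, Matrix.of_apply, div_eq_inv_mul]

theorem det_bn_ne_zero {d : ℕ} {H : Mat d} (hH : H.det ≠ 0) : (bn H).det ≠ 0 := by
  rw [det_bn]
  refine mul_ne_zero (Finset.prod_ne_zero_iff.2 fun i _ => ?_) hH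
  exact inv_ne_zero (Real.sqrt_pos.2 (row_sq_pos hH i)).ne'

theorem rowEnergy_pos {d : ℕ} (hd : 0 < d) {H : Mat d} (hH : H.det ≠ 0) (i : Fin d) :
    0 < rowEnergy H i := by
  have hd' : (0 : ℝ) < d := by exact_mod_cast hd
  have := row_sq_pos hH i
  have := norm_pos_of_det_ne_zero hd hH
  unfold rowEnergy
  positivity

theorem sum_rowEnergy {d : ℕ} (hd : 0 < d) {H : Mat d} (hH : H.det ≠ 0) :
    ∑ i, rowEnergy H i = d := by
  have := norm_pos_of_det_ne_zero hd hH
  unfold rowEnergy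
  rw [← Finset.sum_div, ← Finset.mul_sum, ← frobenius_norm_sq]
  field_simp

theorem gapDrop_eq_sum_log {d : ℕ} (hd : 0 < d) {H : Mat d} (hH : H.det ≠ 0) :
    gapDrop H = ∑ i, -Real.log (rowEnergy H i) := by
  have hd' : (0 : ℝ) < d := by exact_mod_cast hd
  have hn := norm_pos_of_det_ne_zero hd hH
  have hdet2 : (0:ℝ) < H.det ^ 2 := by positivity
  have h1 : ‖bn H‖ ^ 2 / d = 1 := by
    rw [norm_bn_sq fun i => row_sq_pos hH i]; exact div_self hd'.ne'
  have h2 : (bn H).det ^ 2 = (∏ i, (∑ k, H i k ^ 2)⁻¹) * H.det ^ 2 := by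
    rw [det_bn, mul_pow, ← Finset.prod_pow]
    congr 1
    refine Finset.prod_congr rfl fun i _ => ?_
    rw [inv_pow, Real.sq_sqrt (row_sq_pos hH i).le]
  have h3 : Real.log ((bn H).det ^ 2) = -∑ i, Real.log (∑ k, H i k ^ 2) + Real.log (H.det ^ 2) := by
    have : ∀ i, (∑ k, H i k ^ 2)⁻¹ ≠ 0 := fun i => inv_ne_zero (row_sq_pos hH i).ne'
    rw [h2, Real.log_mul (Finset.prod_ne_zero_iff.2 fun i _ => this i) hdet2.ne',
      Real.log_prod fun i _ => this i]
    simp [Real.log_inv]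
  have h4 : ∀ i, Real.log (rowEnergy H i) =
      Real.log (∑ k, H i k ^ 2) - Real.log (‖H‖ ^ 2 / d) := fun i => by
    have := row_sq_pos hH i
    rw [← Real.log_div this.ne' (by positivity), rowEnergy]
    congr 1
    field_simp
  rw [gapDrop, mul_sub, mul_isoGap hd hH, mul_isoGap hd (det_bn_ne_zero hH), h1, h3]
  simp only [h4, Real.log_one]
  simp
  ring

/-- Since the energies have average `1`, the drop is a sum of nonnegative terms. -/
theorem gapDrop_eq_sum {d : ℕ} (hd : 0 < d) {H : Mat d} (hH : H.det ≠ 0) :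
    gapDrop H = ∑ i, (rowEnergy H i - 1 - Real.log (rowEnergy H i)) := by
  rw [gapDrop_eq_sum_log hd hH]
  simp only [Finset.sum_sub_distrib, sum_rowEnergy hd hH]
  simp

theorem sub_one_sub_log_nonneg {y : ℝ} (hy : 0 < y) : 0 ≤ y - 1 - Real.log y := by
  linarith [Real.log_le_sub_one_of_pos hy]

theorem gapDrop_nonneg {d : ℕ} (hd : 0 < d) {H : Mat d} (hH : H.det ≠ 0) : 0 ≤ gapDrop H := by
  rw [gapDrop_eq_sum hd hH]
  exact Finset.sum_nonneg fun i _ => sub_one_sub_log_nonneg (rowEnergy_pos hd hH i)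

theorem two_le_two_add_mul_exp_neg_add {a : ℝ} (ha : 0 ≤ a) :
    2 ≤ (2 + a) * Real.exp (-a) + a := by
  have hmono : MonotoneOn (fun a : ℝ => (2 + a) * Real.exp (-a) + a) (Set.Ici 0) := by
    refine monotoneOn_of_deriv_nonneg (convex_Ici 0) (by fun_prop) (by fun_prop) fun x hx => ?_
    have hd : HasDerivAt (fun a : ℝ => (2 + a) * Real.exp (-a) + a)
        ((1 * Real.exp (-x) + (2 + x) * (Real.exp (-x) * (-1))) + 1) x :=
      ((((hasDerivAt_id x).const_add 2).mul (hasDerivAt_neg x).exp)).add (hasDerivAt_id x)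
    rw [hd.deriv]
    have h1 : (1 + x) * Real.exp (-x) ≤ 1 := by
      rw [Real.exp_neg, ← div_eq_mul_inv, div_le_one (Real.exp_pos x)]
      linarith [Real.add_one_le_exp x]
    linarith
  have := hmono (Set.mem_Ici.2 le_rfl) (Set.mem_Ici.2 ha) ha
  simpa using this

/-- The defect `y - 1 - log y` controls `log (1 / y)`: linearly when it is large, by its square root
when it is small. -/
theorem neg_log_le {y t : ℝ} (hy : 0 < y) (ht : y - 1 - Real.log y ≤ t) :
    -Real.log y ≤ t + √(2 * t) := by
  have ht0 : 0 ≤ t := (sub_one_sub_log_nonneg hy).trans ht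
  rcases le_or_gt (-Real.log y) 0 with h | h
  · have := Real.sqrt_nonneg (2 * t); linarith
  set a := -Real.log y with ha
  have hya : y = Real.exp (-a) := by rw [ha, neg_neg, Real.exp_log hy]
  have h1 := two_le_two_add_mul_exp_neg_add h.le
  rw [← hya] at h1
  have h2 : a ^ 2 ≤ (2 + a) * t := by nlinarith
  by_contra! hcon
  set r := √(2 * t)
  have hr : r ^ 2 = 2 * t := Real.sq_sqrt (by linarith)
  have hr0 : 0 ≤ r := Real.sqrt_nonneg _
  nlinarith

theorem norm_sq_div_le {d : ℕ} (hd : 0 < d) {H : Mat d} (hH : H.det ≠ 0) (i : Fin d) :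
    ‖H‖ ^ 2 / d ≤
      Real.exp ((gapDrop H + √(2 * gapDrop H)) / 2) ^ 2 * ∑ j, H i j ^ 2 := by
  have hd' : (0 : ℝ) < d := by exact_mod_cast hd
  have hn := norm_pos_of_det_ne_zero hd hH
  have hy := rowEnergy_pos hd hH i
  have h1 : rowEnergy H i - 1 - Real.log (rowEnergy H i) ≤ gapDrop H := by
    rw [gapDrop_eq_sum hd hH]
    exact Finset.single_le_sum
      (f := fun i => rowEnergy H i - 1 - Real.log (rowEnergy H i))
      (fun i _ => sub_one_sub_log_nonneg (rowEnergy_pos hd hH i)) (Finset.mem_univ i)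
  have h2 := neg_log_le hy h1
  have h3 : 1 ≤ Real.exp (gapDrop H + √(2 * gapDrop H)) * rowEnergy H i := by
    have := Real.exp_le_exp.2 h2
    rwa [Real.exp_neg, Real.exp_log hy, inv_le_iff_one_le_mul₀ hy] at this
  rw [← Real.exp_nat_mul, Nat.cast_two, mul_div_cancel₀ _ two_ne_zero]
  rw [rowEnergy, ← mul_div_assoc, le_div_iff₀ (by positivity)] at h3
  rw [div_le_iff₀ hd']
  linarith

theorem sq_sub_one_le {d y : ℝ} (hd : 1 ≤ d) (hy : 0 < y) (hyd : y ≤ d) :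
    (y - 1) ^ 2 ≤ 4 * d * (y - 1 - Real.log y) := by
  set r := √y
  have hr0 : 0 < r := Real.sqrt_pos.2 hy
  have hr : r ^ 2 = y := Real.sq_sqrt hy.le
  have h1 : (r - 1) ^ 2 ≤ y - 1 - Real.log y := by
    have := Real.log_le_sub_one_of_pos hr0
    rw [← hr, Real.log_pow]
    push_cast
    nlinarith
  have h2 : (r + 1) ^ 2 ≤ 4 * d := by nlinarith [sq_nonneg (r - 1)]
  calc (y - 1) ^ 2 = (r + 1) ^ 2 * (r - 1) ^ 2 := by rw [← hr]; ring
    _ ≤ 4 * d * (y - 1 - Real.log y) := by gcongr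

theorem sum_rowEnergy_sub_one_sq_le {d : ℕ} (hd : 0 < d) {H : Mat d} (hH : H.det ≠ 0) :
    ∑ i, (rowEnergy H i - 1) ^ 2 ≤ 4 * d * gapDrop H := by
  rw [gapDrop_eq_sum hd hH, Finset.mul_sum]
  refine Finset.sum_le_sum fun i _ => ?_
  refine sq_sub_one_le (by exact_mod_cast hd) (rowEnergy_pos hd hH i) ?_
  rw [← sum_rowEnergy hd hH]
  exact Finset.single_le_sum (f := rowEnergy H) (fun i _ => (rowEnergy_pos hd hH i).le)
    (Finset.mem_univ i)

/-! ### The isometry gap and the spectrum -/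

/-- The deviation from isometry `(d / ‖X‖²) X Xᵀ - 1`. -/
noncomputable def isoDefect {d : ℕ} (X : Mat d) : Mat d :=
  (d / ‖X‖ ^ 2) • (X * X.transpose) - 1

theorem isoDefect_transpose {d : ℕ} (X : Mat d) : (isoDefect X).transpose = isoDefect X := by
  simp [isoDefect, Matrix.transpose_mul]

theorem isoDefect_orthogonal_mul {d : ℕ} (W : Orth d) (X : Mat d) :
    isoDefect ((W : Mat d) * X) = (W : Mat d) * isoDefect X * (W : Mat d).transpose := by
  have hW : (W : Mat d) * (W : Mat d).transpose = 1 := Matrix.mem_unitaryGroup_iff.1 W.2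
  rw [isoDefect, isoDefect, norm_orthogonal_mul W.2, Matrix.mul_sub, Matrix.sub_mul, Matrix.mul_one,
    hW, Matrix.mul_smul, Matrix.smul_mul, Matrix.transpose_mul]
  simp only [Matrix.mul_assoc]

theorem isoDefect_apply_self {d : ℕ} (X : Mat d) (i : Fin d) :
    isoDefect X i i = rowEnergy X i - 1 := by
  simp [isoDefect, rowEnergy, Matrix.mul_apply, sq]
  ring

/-- The numbers `a` are the eigenvalues of `X Xᵀ`, rescaled to have mean `1`. -/
theorem exists_spectrum {d : ℕ} (hd : 0 < d) {X : Mat d} (hX : X.det ≠ 0) :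
    ∃ a : Fin d → ℝ, (∀ i, 0 < a i) ∧ ∑ i, (a i - 1) = 0 ∧ ∑ i, (a i - 1) ^ 2 = ‖isoDefect X‖ ^ 2 ∧
      d * isoGap X = ∑ i, -Real.log (a i) := by
  have hd' : (0 : ℝ) < d := by exact_mod_cast hd
  have hn := norm_pos_of_det_ne_zero hd hX
  have hs : 0 < d / ‖X‖ ^ 2 := by positivity
  set G : Mat d := (d / ‖X‖ ^ 2) • (X * X.transpose) with hG
  have hGpd : G.PosDef := by
    have : (X * X.transpose).PosDef := by
      rw [← Matrix.conjTranspose_eq_transpose_of_trivial]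
      exact Matrix.PosDef.mul_conjTranspose_self X
        (Matrix.vecMul_injective_of_isUnit ((Matrix.isUnit_iff_isUnit_det X).2 hX.isUnit))
    exact this.smul hs
  have hH := hGpd.isHermitian
  have htr : G.trace = d := by
    rw [hG, Matrix.trace_smul, Matrix.trace_mul_comm, ← frobenius_norm_sq_eq_trace, smul_eq_mul]
    field_simp
  have hdet : G.det = (d / ‖X‖ ^ 2) ^ d * X.det ^ 2 := by
    rw [hG, Matrix.det_smul, Matrix.det_mul, Matrix.det_transpose, Fintype.card_fin, sq X.det]
  have htr' : ∑ i, hH.eigenvalues i = d := by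
    rw [← htr, hH.trace_eq_sum_eigenvalues]; simp
  have hsq : (G * G).trace = ∑ i, hH.eigenvalues i ^ 2 := by
    have h := hH.spectral_theorem
    conv_lhs => rw [h]
    rw [← map_mul, Unitary.conjStarAlgAut_apply, Matrix.trace_mul_cycle]
    simp [Matrix.diagonal_mul_diagonal, Matrix.trace_diagonal, sq]
  refine ⟨hH.eigenvalues, hGpd.eigenvalues_pos, ?_, ?_, ?_⟩
  · rw [Finset.sum_sub_distrib, htr']; simp
  · have hT : (isoDefect X).transpose * isoDefect X = G * G - (2 : ℝ) • G + 1 := by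
      rw [isoDefect_transpose, isoDefect, ← hG, two_smul]
      noncomm_ring
    rw [frobenius_norm_sq_eq_trace, hT, Matrix.trace_add, Matrix.trace_sub, Matrix.trace_smul, htr,
      hsq, Matrix.trace_one, Fintype.card_fin]
    simp only [sub_sq, Finset.sum_add_distrib, Finset.sum_sub_distrib, mul_one, ← Finset.mul_sum,
      htr']
    simp
  · have hp : 0 < X.det ^ 2 := by positivity
    have h1 : Real.log G.det = ∑ i, Real.log (hH.eigenvalues i) := by
      rw [hH.det_eq_prod_eigenvalues]
      exact Real.log_prod fun i _ => (hGpd.eigenvalues_pos i).ne'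
    rw [Finset.sum_neg_distrib, ← h1, hdet, Real.log_mul (by positivity) hp.ne', Real.log_pow,
      mul_isoGap hd hX, ← inv_div, Real.log_inv]
    ring

theorem isoGap_nonneg {d : ℕ} (hd : 0 < d) {X : Mat d} (hX : X.det ≠ 0) : 0 ≤ isoGap X := by
  have hd' : (0 : ℝ) < d := by exact_mod_cast hd
  obtain ⟨a, ha, h1, -, h3⟩ := exists_spectrum hd hX
  refine nonneg_of_mul_nonneg_right (a := (d : ℝ)) ?_ hd'
  have : 0 ≤ ∑ i, (a i - 1 - Real.log (a i)) :=
    Finset.sum_nonneg fun i _ => sub_one_sub_log_nonneg (ha i)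
  rw [Finset.sum_sub_distrib (fun i => a i - 1) fun i => Real.log (a i), h1] at this
  rw [h3, Finset.sum_neg_distrib]
  linarith

/-- If all eigenvalues are at least `1 / 2`, the gap is bounded by the sum of the squares of their
deviations from `1`; otherwise this sum is at least `1 / 4`. -/
theorem min_isoGap_le {d : ℕ} (hd : 0 < d) {X : Mat d} (hX : X.det ≠ 0) :
    min (isoGap X) 1 ≤ 4 * ‖isoDefect X‖ ^ 2 := by
  have hd' : (1 : ℝ) ≤ d := by exact_mod_cast hd
  obtain ⟨a, ha, h1, h2, h3⟩ := exists_spectrum hd hX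
  rw [← h2]
  by_cases hsmall : ∃ i, a i < 1 / 2
  · obtain ⟨i, hi⟩ := hsmall
    have := Finset.single_le_sum (f := fun i => (a i - 1) ^ 2) (fun i _ => sq_nonneg _)
      (Finset.mem_univ i)
    refine (min_le_right _ _).trans ?_
    nlinarith
  · push Not at hsmall
    refine (min_le_left _ _).trans ?_
    have h4 : d * isoGap X ≤ ∑ i, 2 * (a i - 1) ^ 2 := by
      have : d * isoGap X = ∑ i, (a i - 1 - Real.log (a i)) := by
        rw [Finset.sum_sub_distrib (fun i => a i - 1) fun i => Real.log (a i), h1, h3,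
          Finset.sum_neg_distrib, zero_sub]
      rw [this]
      refine Finset.sum_le_sum fun i _ => ?_
      have hl := Real.one_sub_inv_le_log_of_pos (ha i)
      have hi := hsmall i
      have h5 : a i - 1 - (1 - (a i)⁻¹) = (a i - 1) ^ 2 / a i := by
        have := (ha i).ne'
        field_simp
      have h6 : (a i - 1) ^ 2 / a i ≤ 2 * (a i - 1) ^ 2 := by
        rw [div_le_iff₀ (ha i)]
        nlinarith [sq_nonneg (a i - 1)]
      linarith
    rw [← Finset.mul_sum] at h4
    have h5 := isoGap_nonneg hd hX
    have h6 : 0 ≤ ∑ i, (a i - 1) ^ 2 := by positivity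
    nlinarith

/-! ### Haar averages of diagonal entries -/

instance isMulLeftInvariant_haarOrth (d : ℕ) : (haarOrth d).IsMulLeftInvariant := by
  unfold haarOrth; infer_instance

instance isProbabilityMeasure_haarOrth (d : ℕ) : IsProbabilityMeasure (haarOrth d) :=
  ⟨Measure.haarMeasure_self (K₀ := (⊤ : TopologicalSpace.PositiveCompacts (Orth d)))⟩

theorem continuous_orth_entry {d : ℕ} (i j : Fin d) :
    Continuous fun w : Orth d => (w : Mat d) i j :=
  (continuous_id.matrix_elem i j).comp continuous_subtype_val

theorem continuous_conj_entry {d : ℕ} (A : Mat d) (i j : Fin d) :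
    Continuous fun w : Orth d => ((w : Mat d) * A * (w : Mat d).transpose) i j :=
  ((continuous_subtype_val.matrix_mul continuous_const).matrix_mul
    continuous_subtype_val.matrix_transpose).matrix_elem i j

theorem integrable_of_continuous {d : ℕ} {f : Orth d → ℝ} (hf : Continuous f) :
    Integrable f (haarOrth d) :=
  integrableOn_univ.1 (hf.continuousOn.integrableOn_compact isCompact_univ)

/-- The reflection that maps `e_i` to `(e_i + e_j) / √2` and `e_j` to `(e_i - e_j) / √2`. -/
noncomputable def diagReflection {d : ℕ} (i j : Fin d) : Mat d :=
  Matrix.of fun a => if a = i then (√2)⁻¹ • (Pi.single i 1 + Pi.single j 1)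
    else if a = j then (√2)⁻¹ • (Pi.single i 1 - Pi.single j 1) else Pi.single a 1

theorem diagReflection_left {d : ℕ} (i j : Fin d) :
    diagReflection i j i = (√2)⁻¹ • (Pi.single i 1 + Pi.single j 1) :=
  if_pos rfl

theorem diagReflection_right {d : ℕ} {i j : Fin d} (hij : i ≠ j) :
    diagReflection i j j = (√2)⁻¹ • (Pi.single i 1 - Pi.single j 1) :=
  (if_neg hij.symm).trans (if_pos rfl)

theorem diagReflection_of_ne {d : ℕ} {i j a : Fin d} (hi : a ≠ i) (hj : a ≠ j) :
    diagReflection i j a = Pi.single a 1 :=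
  (if_neg hi).trans (if_neg hj)

theorem inv_sqrt_two_mul_self : (√2 : ℝ)⁻¹ * (√2)⁻¹ = 1 / 2 := by
  rw [← mul_inv, Real.mul_self_sqrt zero_le_two, one_div]

theorem diagReflection_mem {d : ℕ} {i j : Fin d} (hij : i ≠ j) :
    diagReflection i j ∈ Matrix.unitaryGroup (Fin d) ℝ := by
  have h2 := inv_sqrt_two_mul_self
  have hl := diagReflection_left i j
  have hr := diagReflection_right hij
  rw [Matrix.mem_unitaryGroup_iff]
  ext a b
  change (diagReflection i j a) ⬝ᵥ (diagReflection i j b) = _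
  by_cases hai : a = i
  · subst hai
    by_cases hbi : b = a
    · subst hbi
      rw [hl, smul_dotProduct, dotProduct_smul, smul_smul, h2]
      simp [hij, hij.symm]
      norm_num
    · by_cases hbj : b = j
      · subst hbj
        rw [hl, hr]
        simp [hij, hij.symm]
      · rw [hl, diagReflection_of_ne hbi hbj]
        simp [Ne.symm hbi, hbi, hbj]
  · by_cases haj : a = j
    · subst haj
      by_cases hbi : b = i
      · subst hbi
        rw [hl, hr]
        simp [hij, hij.symm]
      · by_cases hbj : b = a
        · subst hbj
          rw [hr, smul_dotProduct, dotProduct_smul, smul_smul, h2]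
          simp [hij, hij.symm]
          norm_num
        · rw [hr, diagReflection_of_ne hbi hbj]
          simp [Ne.symm hbj, hbi, hbj]
    · rw [diagReflection_of_ne hai haj]
      by_cases hbi : b = i
      · subst hbi
        rw [hl]
        simp [hai, haj]
      · by_cases hbj : b = j
        · subst hbj
          rw [hr]
          simp [hai, haj]
        · rw [diagReflection_of_ne hbi hbj]
          simp [Matrix.one_apply, Pi.single_apply, eq_comm]

theorem conj_diagReflection_sq {d : ℕ} {i j : Fin d} (hij : i ≠ j) {B : Mat d}
    (hB : B.transpose = B) :
    2 * B i j ^ 2 ≤ (diagReflection i j * B * (diagReflection i j).transpose) i i ^ 2 +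
      (diagReflection i j * B * (diagReflection i j).transpose) j j ^ 2 := by
  have h2 := inv_sqrt_two_mul_self
  have hs : B j i = B i j := congrFun (congrFun hB i) j
  have hconj : ∀ a, (diagReflection i j * B * (diagReflection i j).transpose) a a =
      (diagReflection i j a) ⬝ᵥ (B.mulVec (diagReflection i j a)) := fun a => by
    rw [Matrix.mul_assoc]; rfl
  have hi : (diagReflection i j * B * (diagReflection i j).transpose) i i =
      (B i i + B j j) / 2 + B i j := by
    rw [hconj]
    rw [diagReflection_left, Matrix.mulVec_smul, smul_dotProduct, dotProduct_smul, smul_smul, h2]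
    simp [Matrix.mulVec_add, hs]
    ring
  have hj : (diagReflection i j * B * (diagReflection i j).transpose) j j =
      (B i i + B j j) / 2 - B i j := by
    rw [hconj]
    rw [diagReflection_right hij, Matrix.mulVec_smul, smul_dotProduct, dotProduct_smul, smul_smul,
      h2]
    simp [Matrix.mulVec_sub, hs]
    ring
  rw [hi, hj]
  nlinarith [sq_nonneg (B i i + B j j)]

/-- Under Haar conjugation of a symmetric matrix the off-diagonal entries are on average no larger
than the diagonal ones, because a reflection in the plane of two coordinates turns the former into
the latter. -/
theorem norm_sq_le_integral_diag {d : ℕ} {A : Mat d} (hA : A.transpose = A) :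
    ‖A‖ ^ 2 ≤ d * ∫ w : Orth d, ∑ i, ((w : Mat d) * A * (w : Mat d).transpose) i i ^ 2
      ∂haarOrth d := by
  set B : Orth d → Mat d := fun w => (w : Mat d) * A * (w : Mat d).transpose with hBdef
  have hBc : ∀ i j, Continuous fun w => B w i j := continuous_conj_entry A
  have hBi : ∀ i j, Integrable (fun w => B w i j ^ 2) (haarOrth d) := fun i j =>
    integrable_of_continuous ((hBc i j).pow 2)
  have hBs : ∀ w, (B w).transpose = B w := fun w => by
    simp [hBdef, Matrix.transpose_mul, hA, Matrix.mul_assoc]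
  have hoff : ∀ i j, i ≠ j → 2 * ∫ w, B w i j ^ 2 ∂haarOrth d ≤
      (∫ w, B w i i ^ 2 ∂haarOrth d) + ∫ w, B w j j ^ 2 ∂haarOrth d := by
    intro i j hij
    let Q : Orth d := ⟨diagReflection i j, diagReflection_mem hij⟩
    have hQ : ∀ w, B (Q * w) = diagReflection i j * B w * (diagReflection i j).transpose := by
      intro w
      have hc : ((Q * w : Orth d) : Mat d) = diagReflection i j * (w : Mat d) := rfl
      simp only [hBdef, hc, Matrix.transpose_mul, Matrix.mul_assoc]
    rw [← integral_add (hBi i i) (hBi j j), ← integral_const_mul,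
      ← integral_mul_left_eq_self (fun w => B w i i ^ 2 + B w j j ^ 2) Q]
    have hcont : Continuous fun w => B (Q * w) i i ^ 2 + B (Q * w) j j ^ 2 :=
      (((hBc i i).comp (continuous_const_mul Q)).pow 2).add
        (((hBc j j).comp (continuous_const_mul Q)).pow 2)
    refine integral_mono ((hBi i j).const_mul 2) (integrable_of_continuous hcont) fun w => ?_
    simp only [hQ]
    exact conj_diagReflection_sq hij (hBs w)
  have hpair : ∀ i j, 2 * ∫ w, B w i j ^ 2 ∂haarOrth d ≤
      (∫ w, B w i i ^ 2 ∂haarOrth d) + ∫ w, B w j j ^ 2 ∂haarOrth d := by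
    intro i j
    rcases eq_or_ne i j with rfl | hij
    · exact (two_mul _).le
    · exact hoff i j hij
  have hnorm : ∀ w, ‖A‖ ^ 2 = ∑ i, ∑ j, B w i j ^ 2 := by
    intro w
    rw [← frobenius_norm_sq]
    simp only [hBdef]
    rw [Matrix.mul_assoc, norm_orthogonal_mul w.2,
      ← Matrix.frobenius_norm_transpose (A * (w : Mat d).transpose), Matrix.transpose_mul,
      Matrix.transpose_transpose, norm_orthogonal_mul w.2, hA]
  have htot : ‖A‖ ^ 2 = ∑ i, ∑ j, ∫ w, B w i j ^ 2 ∂haarOrth d := by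
    have : ‖A‖ ^ 2 = ∫ w, ∑ i, ∑ j, B w i j ^ 2 ∂haarOrth d := by
      simp only [← hnorm]; simp
    rw [this, integral_finsetSum _ fun i _ => integrable_finsetSum _ fun j _ => hBi i j]
    exact Finset.sum_congr rfl fun i _ => integral_finsetSum _ fun j _ => hBi i j
  rw [integral_finsetSum _ fun i _ => hBi i i, htot]
  have : ∑ i, ∑ j, 2 * ∫ w, B w i j ^ 2 ∂haarOrth d ≤ ∑ i, ∑ j,
      ((∫ w, B w i i ^ 2 ∂haarOrth d) + ∫ w, B w j j ^ 2 ∂haarOrth d) :=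
    Finset.sum_le_sum fun i _ => Finset.sum_le_sum fun j _ => hpair i j
  simp only [← Finset.mul_sum, Finset.sum_add_distrib, Finset.sum_const, Finset.card_univ,
    Fintype.card_fin, nsmul_eq_mul] at this
  linarith

/-! ### Expected decrease of the isometry gap -/

theorem continuous_gapDrop_orth_mul {d : ℕ} (hd : 0 < d) {X : Mat d} (hX : X.det ≠ 0) :
    Continuous fun w : Orth d => gapDrop ((w : Mat d) * X) := by
  have hdet : ∀ w : Orth d, ((w : Mat d) * X).det ≠ 0 := fun w =>
    det_orthogonal_mul_ne_zero w.2 hX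
  have h1 : (fun w : Orth d => gapDrop ((w : Mat d) * X)) =
      fun w : Orth d => ∑ i, -Real.log (rowEnergy ((w : Mat d) * X) i) :=
    funext fun w => gapDrop_eq_sum_log hd (hdet w)
  rw [h1]
  refine continuous_finsetSum _ fun i _ => Continuous.neg (Continuous.log ?_ fun w =>
    (rowEnergy_pos hd (hdet w) i).ne')
  have h2 : ∀ j, Continuous fun w : Orth d => ((w : Mat d) * X) i j := fun j =>
    (continuous_subtype_val.matrix_mul continuous_const).matrix_elem i j
  have h3 : ∀ w : Orth d, ‖(w : Mat d) * X‖ = ‖X‖ := fun w => norm_orthogonal_mul w.2 X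
  simp only [rowEnergy, h3]
  exact (continuous_const.mul (continuous_finsetSum _ fun j _ => (h2 j).pow 2)).div_const _

theorem min_isoGap_le_integral {d : ℕ} (hd : 0 < d) {X : Mat d} (hX : X.det ≠ 0) :
    min (isoGap X) 1 ≤ 16 * d ^ 2 * ∫ w : Orth d, gapDrop ((w : Mat d) * X) ∂haarOrth d := by
  have hd' : (0 : ℝ) < d := by exact_mod_cast hd
  have hdrop := integrable_of_continuous (continuous_gapDrop_orth_mul hd hX)
  have h1 : ∫ w : Orth d, ∑ i, ((w : Mat d) * isoDefect X * (w : Mat d).transpose) i i ^ 2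
      ∂haarOrth d ≤ ∫ w : Orth d, 4 * d * gapDrop ((w : Mat d) * X) ∂haarOrth d := by
    refine integral_mono (integrable_of_continuous (continuous_finsetSum _ fun i _ =>
      (continuous_conj_entry (isoDefect X) i i).pow 2)) (hdrop.const_mul _) fun w => ?_
    simp only [← isoDefect_orthogonal_mul, isoDefect_apply_self]
    exact sum_rowEnergy_sub_one_sq_le hd (det_orthogonal_mul_ne_zero w.2 hX)
  rw [integral_const_mul] at h1
  calc min (isoGap X) 1 ≤ 4 * ‖isoDefect X‖ ^ 2 := min_isoGap_le hd hX
    _ ≤ 4 * (d * ∫ w : Orth d, ∑ i, ((w : Mat d) * isoDefect X * (w : Mat d).transpose) i i ^ 2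
        ∂haarOrth d) := by gcongr; exact norm_sq_le_integral_diag (isoDefect_transpose X)
    _ ≤ 4 * (d * (4 * d * ∫ w : Orth d, gapDrop ((w : Mat d) * X) ∂haarOrth d)) := by gcongr
    _ = _ := by ring

/-- The Lyapunov function `18 d² (√φ + φ)`. Its derivative is large where the isometry gap `φ` is
small, so that its decrease pays for the square root of the decrease of `φ`. -/
noncomputable def lyapunov (d : ℕ) (φ : ℝ) : ℝ := 18 * d ^ 2 * (√φ + φ)

theorem lyapunov_nonneg (d : ℕ) {φ : ℝ} (hφ : 0 ≤ φ) : 0 ≤ lyapunov d φ := by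
  unfold lyapunov; positivity

theorem sqrt_two_mul_le {t s : ℝ} (ht : 0 ≤ t) (hs : 0 < s) : √(2 * t) ≤ t / s + s / 2 := by
  refine Real.sqrt_le_iff.2 ⟨by positivity, ?_⟩
  have h : (t / s + s / 2) ^ 2 - 2 * t = (t / s - s / 2) ^ 2 := by field_simp; ring
  nlinarith [sq_nonneg (t / s - s / 2)]

theorem isoGap_bn_eq {d : ℕ} (hd : 0 < d) (w : Orth d) (X : Mat d) :
    isoGap (bn ((w : Mat d) * X)) = isoGap X - gapDrop ((w : Mat d) * X) / d := by
  have hd' : (d : ℝ) ≠ 0 := by exact_mod_cast hd.ne'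
  rw [gapDrop, isoGap_orthogonal_mul w.2, mul_div_cancel_left₀ _ hd']
  ring

theorem gapDrop_le {d : ℕ} (hd : 0 < d) (w : Orth d) {X : Mat d} (hX : X.det ≠ 0) :
    gapDrop ((w : Mat d) * X) ≤ d * isoGap X := by
  have hd' : (0 : ℝ) < d := by exact_mod_cast hd
  have := isoGap_nonneg hd (det_bn_ne_zero (det_orthogonal_mul_ne_zero w.2 hX))
  rw [isoGap_bn_eq hd, sub_nonneg, div_le_iff₀ hd'] at this
  linarith

/-- The bound `√(2t) ≤ t / s + s / 2`, with `s` depending on the gap, estimates the integrand by an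
affine function of the drop `t`, whose mean is bounded below by `min_isoGap_le_integral`. -/
theorem integral_sqrt_gapDrop_le {d : ℕ} (hd : 0 < d) {X : Mat d} (hX : X.det ≠ 0) :
    ∫ w : Orth d, (√(2 * gapDrop ((w : Mat d) * X)) +
      lyapunov d (isoGap (bn ((w : Mat d) * X)))) ∂haarOrth d ≤ lyapunov d (isoGap X) := by
  have hd' : (0 : ℝ) < d := by exact_mod_cast hd
  have hφ := isoGap_nonneg hd hX
  have htc := continuous_gapDrop_orth_mul hd hX
  have ht0 : ∀ w : Orth d, 0 ≤ gapDrop ((w : Mat d) * X) := fun w =>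
    gapDrop_nonneg hd (det_orthogonal_mul_ne_zero w.2 hX)
  have htle : ∀ w : Orth d, gapDrop ((w : Mat d) * X) ≤ d * isoGap X := fun w => gapDrop_le hd w hX
  have hmin := min_isoGap_le_integral hd hX
  have hint := integrable_of_continuous htc
  have hc : Continuous fun w : Orth d => √(2 * gapDrop ((w : Mat d) * X)) +
      lyapunov d (isoGap (bn ((w : Mat d) * X))) := by
    simp only [isoGap_bn_eq hd, lyapunov]
    fun_prop
  have hT : 0 ≤ ∫ w : Orth d, gapDrop ((w : Mat d) * X) ∂haarOrth d := integral_nonneg ht0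
  set φ := isoGap X with hφdef
  set T := ∫ w : Orth d, gapDrop ((w : Mat d) * X) ∂haarOrth d with hTdef
  -- it suffices to bound the integrand by an affine function of the drop
  suffices h : ∃ α β : ℝ, (∀ w : Orth d, √(2 * gapDrop ((w : Mat d) * X)) +
      lyapunov d (isoGap (bn ((w : Mat d) * X))) ≤
        α * gapDrop ((w : Mat d) * X) + (β + lyapunov d φ)) ∧ α * T + β ≤ 0 by
    obtain ⟨α, β, h1, h2⟩ := h
    calc _ ≤ ∫ w : Orth d, (α * gapDrop ((w : Mat d) * X) + (β + lyapunov d φ)) ∂haarOrth d :=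
          integral_mono (integrable_of_continuous hc)
            ((hint.const_mul α).add (integrable_const _)) h1
      _ = α * T + (β + lyapunov d φ) := by
          rw [integral_add (hint.const_mul α) (integrable_const _), integral_const_mul]
          simp [hTdef]
      _ ≤ lyapunov d φ := by linarith
  rcases hφ.eq_or_lt with h0 | hpos
  · refine ⟨0, 0, fun w => ?_, by simp⟩
    have h1 : gapDrop ((w : Mat d) * X) = 0 :=
      le_antisymm (by simpa [← h0] using htle w) (ht0 w)
    rw [isoGap_bn_eq hd, h1, ← hφdef]
    simp
  rcases le_total φ 1 with h1 | h1
  · rw [min_eq_left h1] at hmin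
    have hr : 0 < √φ := Real.sqrt_pos.2 hpos
    have hrs : √φ ^ 2 = φ := Real.sq_sqrt hφ
    refine ⟨-(8 * d / √φ), √φ / (2 * d), fun w => ?_, ?_⟩
    · -- `s = √φ / d` balances `t / s` with `s / 2`, as `E t` is at least of order `φ / d²`
      have ha := sqrt_two_mul_le (ht0 w) (div_pos hr hd')
      rw [isoGap_bn_eq hd, ← hφdef]
      set t := gapDrop ((w : Mat d) * X)
      have hx : 0 ≤ φ - t / d := by
        rw [sub_nonneg, div_le_iff₀ hd', mul_comm]; exact htle w
      have hb : √(φ - t / d) ≤ √φ - t / (2 * d * √φ) := by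
        refine Real.sqrt_le_iff.2 ⟨?_, ?_⟩
        · rw [sub_nonneg, div_le_iff₀ (by positivity)]
          have : √φ * (2 * d * √φ) = 2 * (d * φ) := by rw [← hrs, Real.sqrt_sq hr.le]; ring
          have h3 : 0 ≤ d * φ := by positivity
          linarith [htle w]
        · have h4 : (√φ - t / (2 * d * √φ)) ^ 2 = √φ ^ 2 - t / d + (t / (2 * d * √φ)) ^ 2 := by
            field_simp; ring
          rw [h4, hrs]
          nlinarith [sq_nonneg (t / (2 * d * √φ))]
      have hc1 : lyapunov d (φ - t / d) ≤ lyapunov d φ - 9 * d * t / √φ := by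
        have ht : 0 ≤ t / d := div_nonneg (ht0 w) hd'.le
        have h5 : 18 * (d : ℝ) ^ 2 * (t / (2 * d * √φ)) = 9 * d * t / √φ := by field_simp; ring
        rw [← h5]
        unfold lyapunov
        rw [← mul_sub]
        gcongr
        linarith
      have hd1 : t / (√φ / d) + √φ / d / 2 = d * t / √φ + √φ / (2 * d) := by
        field_simp
      rw [hd1] at ha
      have he : -(8 * d / √φ) * t = d * t / √φ - 9 * d * t / √φ := by ring
      rw [he]
      linarith
    · have : √φ / (2 * d) = φ / (2 * d * √φ) := by
        rw [div_eq_div_iff (by positivity) (by positivity)]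
        nlinarith
      rw [this]
      have h6 : φ / (2 * d * √φ) ≤ 16 * d ^ 2 * T / (2 * d * √φ) := by gcongr
      have h7 : 16 * d ^ 2 * T / (2 * d * √φ) = 8 * d / √φ * T := by field_simp; ring
      linarith
  · rw [min_eq_right h1] at hmin
    refine ⟨-(17 * d), 1 / (2 * d), fun w => ?_, ?_⟩
    · -- here `E t` is at least of order `1 / d²`, and `s = 1 / d`
      have ha := sqrt_two_mul_le (ht0 w) (inv_pos.2 hd')
      rw [isoGap_bn_eq hd, ← hφdef]
      set t := gapDrop ((w : Mat d) * X)
      have ht : 0 ≤ t / d := div_nonneg (ht0 w) hd'.le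
      have hc1 : lyapunov d (φ - t / d) ≤ lyapunov d φ - 18 * d * t := by
        have h5 : 18 * (d : ℝ) ^ 2 * (t / d) = 18 * d * t := by field_simp
        rw [← h5]
        unfold lyapunov
        rw [← mul_sub]
        have h8 : √(φ - t / d) ≤ √φ := Real.sqrt_le_sqrt (by linarith)
        gcongr
        linarith
      have hd1 : t / (d : ℝ)⁻¹ + (d : ℝ)⁻¹ / 2 = d * t + 1 / (2 * d) := by
        field_simp
      rw [hd1] at ha
      linarith
    · have h6 : 1 / (2 * d) ≤ 16 * d ^ 2 * T / (2 * d) := by gcongr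
      have h7 : 16 * d ^ 2 * T / (2 * d) = 8 * d * T := by field_simp; ring
      have h8 : 0 ≤ d * T := by positivity
      linarith

theorem lintegral_sqrt_gapDrop_le {d : ℕ} (hd : 0 < d) {X : Mat d} (hX : X.det ≠ 0) :
    ∫⁻ w : Orth d, (ENNReal.ofReal √(2 * gapDrop ((w : Mat d) * X)) +
      ENNReal.ofReal (lyapunov d (isoGap (bn ((w : Mat d) * X))))) ∂haarOrth d ≤
        ENNReal.ofReal (lyapunov d (isoGap X)) := by
  have htc := continuous_gapDrop_orth_mul hd hX
  have hV : ∀ w : Orth d, 0 ≤ lyapunov d (isoGap (bn ((w : Mat d) * X))) := fun w =>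
    lyapunov_nonneg d (isoGap_nonneg hd (det_bn_ne_zero (det_orthogonal_mul_ne_zero w.2 hX)))
  have hc : Continuous fun w : Orth d => √(2 * gapDrop ((w : Mat d) * X)) +
      lyapunov d (isoGap (bn ((w : Mat d) * X))) := by
    simp only [isoGap_bn_eq hd, lyapunov]
    fun_prop
  simp only [← ENNReal.ofReal_add (Real.sqrt_nonneg _) (hV _)]
  rw [← ofReal_integral_eq_lintegral_ofReal (integrable_of_continuous hc)
    (ae_of_all _ fun w => add_nonneg (Real.sqrt_nonneg _) (hV w))]
  exact ENNReal.ofReal_le_ofReal (integral_sqrt_gapDrop_le hd hX)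

/-! ### Summation along the layers -/

theorem measurable_isoGap {α : Type*} [MeasurableSpace α] {d : ℕ} {H : α → Mat d}
    (hH : ∀ i j, Measurable fun a => H a i j) : Measurable fun a => isoGap (H a) := by
  unfold isoGap
  simp only [Matrix.trace, Matrix.diag, Matrix.det_apply, Matrix.mul_apply,
    Matrix.transpose_apply]
  fun_prop

theorem measurable_bn {α : Type*} [MeasurableSpace α] {d : ℕ} {H : α → Mat d}
    (hH : ∀ i j, Measurable fun a => H a i j) (i j : Fin d) : Measurable fun a => bn (H a) i j := by
  simp only [bn, Matrix.of_apply]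
  fun_prop

theorem measurable_mul {α : Type*} [MeasurableSpace α] {d : ℕ} {H H' : α → Mat d}
    (hH : ∀ i j, Measurable fun a => H a i j) (hH' : ∀ i j, Measurable fun a => H' a i j)
    (i j : Fin d) : Measurable fun a => (H a * H' a) i j := by
  simp only [Matrix.mul_apply]
  fun_prop

theorem measurable_rep {α : Type*} [MeasurableSpace α] {d : ℕ} {W : ℕ → α → Mat d}
    (hW : ∀ k i j, Measurable fun a => W k a i j) (X₀ : Mat d) (n : ℕ) (i j : Fin d) :
    Measurable fun a => rep (fun k => W k a) X₀ n i j := by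
  induction n generalizing i j with
  | zero => exact measurable_const
  | succ n ih => exact measurable_bn (measurable_mul (hW n) ih) i j

theorem rep_congr {d : ℕ} {W W' : ℕ → Mat d} (X₀ : Mat d) {n : ℕ} (h : ∀ k < n, W k = W' k) :
    rep W X₀ n = rep W' X₀ n := by
  induction n with
  | zero => rfl
  | succ n ih => rw [rep, rep, h n n.lt_succ_self, ih fun k hk => h k (by omega)]

theorem det_rep_ne_zero {d : ℕ} {W : ℕ → Mat d} (hW : ∀ k, W k ∈ Matrix.unitaryGroup (Fin d) ℝ)
    {X₀ : Mat d} (hX₀ : X₀.det ≠ 0) (n : ℕ) : (rep W X₀ n).det ≠ 0 := by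
  induction n with
  | zero => exact hX₀
  | succ n ih => exact det_bn_ne_zero (det_orthogonal_mul_ne_zero (hW n) ih)

/-- The weights of the first `n` layers, continued by identity matrices. -/
def extendWeights {d n : ℕ} (v : Finset.range n → Orth d) (k : ℕ) : Orth d :=
  if h : k ∈ Finset.range n then v ⟨k, h⟩ else 1

section Layers

variable {d : ℕ} {Ω : Type*} [MeasurableSpace Ω] {P : Measure Ω}

/-- The weights of a layer are independent of its input. -/
theorem map_weights_eq_prod [IsProbabilityMeasure P] {W : ℕ → Ω → Orth d}
    (hlaw : ∀ k, HasLaw (W k) (haarOrth d) P) (hindep : iIndepFun W P) (n : ℕ) :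
    P.map (fun ω => ((fun k : Finset.range n => W k ω), W n ω)) =
      (P.map fun ω => fun k : Finset.range n => W k ω).prod (haarOrth d) := by
  have hm : ∀ k, AEMeasurable (W k) P := fun k => (hlaw k).aemeasurable
  have h1 := hindep.indepFun_finset₀ (Finset.range n) {n} (by simp) hm
  have h2 := h1.comp measurable_id
    (measurable_pi_apply (⟨n, Finset.mem_singleton_self n⟩ : ({n} : Finset ℕ)))
  have h3 := (indepFun_iff_map_prod_eq_prod_map_map
    (aemeasurable_pi_lambda (fun ω => fun k : Finset.range n => W k ω) fun k => hm k) (hm n)).1 h2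
  rw [(hlaw n).map_eq] at h3
  exact h3

theorem measurable_orth_entry {α : Type*} [MeasurableSpace α] {f : α → Orth d} (hf : Measurable f)
    (i j : Fin d) : Measurable fun a => (f a : Mat d) i j :=
  (continuous_orth_entry i j).measurable.comp hf

theorem measurable_extendWeights (n k : ℕ) :
    Measurable fun v : Finset.range n → Orth d => extendWeights v k := by
  unfold extendWeights
  split_ifs with h
  · exact measurable_pi_apply _
  · exact measurable_const

theorem rep_extendWeights (W : ℕ → Orth d) (X₀ : Mat d) (n : ℕ) :
    rep (fun k => (extendWeights (fun k : Finset.range n => W k) k : Mat d)) X₀ n =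
      rep (fun k => (W k : Mat d)) X₀ n :=
  rep_congr X₀ fun k hk => by simp [extendWeights, hk]

/-- One layer on average: the Lyapunov function pays for the square root of the drop. -/
theorem lintegral_layer_le [IsProbabilityMeasure P] (hd : 0 < d) {X₀ : Mat d} (hX₀ : X₀.det ≠ 0)
    {W : ℕ → Ω → Orth d} (hlaw : ∀ k, HasLaw (W k) (haarOrth d) P) (hindep : iIndepFun W P)
    (n : ℕ) :
    ∫⁻ ω, ENNReal.ofReal √(2 * gapDrop ((W n ω : Mat d) * rep (fun k => (W k ω : Mat d)) X₀ n)) ∂P +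
      ∫⁻ ω, ENNReal.ofReal (lyapunov d (isoGap (rep (fun k => (W k ω : Mat d)) X₀ (n + 1)))) ∂P ≤
    ∫⁻ ω, ENNReal.ofReal (lyapunov d (isoGap (rep (fun k => (W k ω : Mat d)) X₀ n))) ∂P := by
  let R : (Finset.range n → Orth d) → Mat d :=
    fun v => rep (fun k => (extendWeights v k : Mat d)) X₀ n
  have hR : ∀ i j, Measurable fun v => R v i j :=
    measurable_rep (fun k => measurable_orth_entry (measurable_extendWeights n k)) X₀ n
  have hRdet : ∀ v, (R v).det ≠ 0 := fun v =>
    det_rep_ne_zero (W := fun k => (extendWeights v k : Mat d)) (fun k => (extendWeights v k).2)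
      hX₀ n
  have hRW : ∀ ω, R (fun k : Finset.range n => W k ω) = rep (fun k => (W k ω : Mat d)) X₀ n :=
    fun ω => rep_extendWeights (fun k => W k ω) X₀ n
  let τ : Ω → (Finset.range n → Orth d) × Orth d :=
    fun ω => ((fun k : Finset.range n => W k ω), W n ω)
  have hτ1 : AEMeasurable (fun ω => fun k : Finset.range n => W k ω) P :=
    aemeasurable_pi_lambda _ fun k => (hlaw k).aemeasurable
  have hτ : AEMeasurable τ P := hτ1.prodMk (hlaw n).aemeasurable
  have hH : ∀ i j, Measurable fun p : (Finset.range n → Orth d) × Orth d =>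
      ((p.2 : Mat d) * R p.1) i j :=
    measurable_mul (measurable_orth_entry measurable_snd) fun i j => (hR i j).comp measurable_fst
  let f : (Finset.range n → Orth d) × Orth d → ℝ≥0∞ :=
    fun p => ENNReal.ofReal √(2 * gapDrop ((p.2 : Mat d) * R p.1))
  let g : (Finset.range n → Orth d) × Orth d → ℝ≥0∞ :=
    fun p => ENNReal.ofReal (lyapunov d (isoGap (bn ((p.2 : Mat d) * R p.1))))
  have hφ := measurable_isoGap hH
  have hφ' := measurable_isoGap (measurable_bn hH)
  have hf : Measurable f := by
    simp only [f, gapDrop]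
    fun_prop
  have hg : Measurable g := by
    simp only [g, lyapunov]
    fun_prop
  have hfτ : AEMeasurable (fun ω => f (τ ω)) P := by
    have h := hf.comp_aemeasurable hτ
    simpa only [Function.comp_def] using h
  have hstep : ∀ v, ∫⁻ w, (f (v, w) + g (v, w)) ∂haarOrth d ≤
      ENNReal.ofReal (lyapunov d (isoGap (R v))) := fun v => by
    have h := lintegral_sqrt_gapDrop_le hd (hRdet v)
    exact h
  calc _ = ∫⁻ ω, f (τ ω) ∂P + ∫⁻ ω, g (τ ω) ∂P := by
        simp only [f, g, τ, hRW, rep]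
    _ = ∫⁻ ω, (f (τ ω) + g (τ ω)) ∂P := (lintegral_add_left' hfτ _).symm
    _ = ∫⁻ p, (f p + g p) ∂(P.map τ) := (lintegral_map' (hf.add hg).aemeasurable hτ).symm
    _ = ∫⁻ v, ∫⁻ w, (f (v, w) + g (v, w)) ∂haarOrth d
          ∂(P.map fun ω => fun k : Finset.range n => W k ω) := by
        rw [map_weights_eq_prod hlaw hindep n]
        exact lintegral_prod _ (hf.add hg).aemeasurable
    _ ≤ ∫⁻ v, ENNReal.ofReal (lyapunov d (isoGap (R v)))
          ∂(P.map fun ω => fun k : Finset.range n => W k ω) :=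
        lintegral_mono hstep
    _ = _ := by
        have hφR := measurable_isoGap hR
        have hgR : Measurable fun v => ENNReal.ofReal (lyapunov d (isoGap (R v))) := by
          simp only [lyapunov]
          fun_prop
        rw [lintegral_map' hgR.aemeasurable hτ1]
        simp only [hRW]

theorem aemeasurable_gapDrop_layer {X₀ : Mat d} {W : ℕ → Ω → Orth d}
    (hW : ∀ k, AEMeasurable (W k) P) (n : ℕ) :
    AEMeasurable (fun ω =>
      gapDrop ((W n ω : Mat d) * rep (fun k => (W k ω : Mat d)) X₀ n)) P := by
  have hm : Measurable fun v : ℕ → Orth d =>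
      gapDrop ((v n : Mat d) * rep (fun k => (v k : Mat d)) X₀ n) := by
    have h1 : ∀ k i j, Measurable fun v : ℕ → Orth d => (v k : Mat d) i j := fun k =>
      measurable_orth_entry (measurable_pi_apply k)
    have hH := measurable_mul (h1 n) (measurable_rep h1 X₀ n)
    have hφ := measurable_isoGap hH
    have hφ' := measurable_isoGap (measurable_bn hH)
    simp only [gapDrop]
    fun_prop
  have h := hm.comp_aemeasurable (aemeasurable_pi_lambda (fun ω k => W k ω) hW)
  simpa only [Function.comp_def] using h

theorem sum_lintegral_sqrt_gapDrop_le [IsProbabilityMeasure P] (hd : 0 < d) {X₀ : Mat d}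
    (hX₀ : X₀.det ≠ 0) {W : ℕ → Ω → Orth d} (hlaw : ∀ k, HasLaw (W k) (haarOrth d) P)
    (hindep : iIndepFun W P) (n : ℕ) :
    ∑ m ∈ Finset.range n, ∫⁻ ω, ENNReal.ofReal
      √(2 * gapDrop ((W m ω : Mat d) * rep (fun k => (W k ω : Mat d)) X₀ m)) ∂P ≤
    ENNReal.ofReal (lyapunov d (isoGap X₀)) := by
  have h : ∀ n, ∑ m ∈ Finset.range n, ∫⁻ ω, ENNReal.ofReal
      √(2 * gapDrop ((W m ω : Mat d) * rep (fun k => (W k ω : Mat d)) X₀ m)) ∂P +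
      ∫⁻ ω, ENNReal.ofReal (lyapunov d (isoGap (rep (fun k => (W k ω : Mat d)) X₀ n))) ∂P ≤
      ENNReal.ofReal (lyapunov d (isoGap X₀)) := by
    intro n
    induction n with
    | zero => simp [rep]
    | succ n ih =>
      rw [Finset.sum_range_succ, add_assoc]
      exact (add_le_add_right (lintegral_layer_le hd hX₀ hlaw hindep n) _).trans ih
  exact le_self_add.trans (h n)

end Layers

/-! ### The logarithm of the gradient norm -/

/-- The bound `t + √(2t)` for twice the logarithmic amplification of a gradient in layer `m`, where
`t` is the drop in that layer of `d` times the isometry gap. -/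
noncomputable def layerGain {d : ℕ} (W : ℕ → Mat d) (X₀ : Mat d) (m : ℕ) : ℝ :=
  gapDrop (W m * rep W X₀ m) + √(2 * gapDrop (W m * rep W X₀ m))

/-- A bound for the logarithm of the gradient norm of a `K`-Lipschitz loss behind at most `L + 1`
layers, with the crude summands `K ≥ log K` (which makes sense for `K = 0`) and `d ≥ log √d`. -/
noncomputable def logGradBound {d : ℕ} (K : ℝ≥0) (W : ℕ → Mat d) (X₀ : Mat d) (L : ℕ) : ℝ :=
  K + d + (∑ m ∈ Finset.range (L + 1), layerGain W X₀ m) / 2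

theorem gapDrop_layer_nonneg {d : ℕ} (hd : 0 < d) {W : ℕ → Mat d}
    (hW : ∀ k, W k ∈ Matrix.unitaryGroup (Fin d) ℝ) {X₀ : Mat d} (hX₀ : X₀.det ≠ 0) (m : ℕ) :
    0 ≤ gapDrop (W m * rep W X₀ m) :=
  gapDrop_nonneg hd (det_orthogonal_mul_ne_zero (hW m) (det_rep_ne_zero hW hX₀ m))

theorem layerGain_nonneg {d : ℕ} (hd : 0 < d) {W : ℕ → Mat d}
    (hW : ∀ k, W k ∈ Matrix.unitaryGroup (Fin d) ℝ) {X₀ : Mat d} (hX₀ : X₀.det ≠ 0) (m : ℕ) :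
    0 ≤ layerGain W X₀ m :=
  add_nonneg (gapDrop_layer_nonneg hd hW hX₀ m) (Real.sqrt_nonneg _)

theorem sum_gapDrop_le {d : ℕ} (hd : 0 < d) {W : ℕ → Mat d}
    (hW : ∀ k, W k ∈ Matrix.unitaryGroup (Fin d) ℝ) {X₀ : Mat d} (hX₀ : X₀.det ≠ 0) (n : ℕ) :
    ∑ m ∈ Finset.range n, gapDrop (W m * rep W X₀ m) ≤ d * isoGap X₀ := by
  have h : ∀ m, gapDrop (W m * rep W X₀ m) =
      d * isoGap (rep W X₀ m) - d * isoGap (rep W X₀ (m + 1)) := fun m => by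
    rw [gapDrop, isoGap_orthogonal_mul (hW m), mul_sub, rep]
  rw [Finset.sum_congr rfl fun m _ => h m,
    Finset.sum_range_sub' fun m => d * isoGap (rep W X₀ m)]
  have := isoGap_nonneg hd (det_rep_ne_zero hW hX₀ n)
  have h0 : 0 ≤ d * isoGap (rep W X₀ n) := by positivity
  rw [rep]
  linarith

/-- A sure bound, which is the better one for shallow networks. -/
theorem logGradBound_le {d : ℕ} (hd : 0 < d) (K : ℝ≥0) {W : ℕ → Mat d}
    (hW : ∀ k, W k ∈ Matrix.unitaryGroup (Fin d) ℝ) {X₀ : Mat d} (hX₀ : X₀.det ≠ 0) (L : ℕ) :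
    logGradBound K W X₀ L ≤ K + d + d * isoGap X₀ + (L + 1) := by
  have h1 : ∑ m ∈ Finset.range (L + 1), layerGain W X₀ m ≤
      ∑ m ∈ Finset.range (L + 1), (2 * gapDrop (W m * rep W X₀ m) + 1) := by
    refine Finset.sum_le_sum fun m _ => ?_
    have := sqrt_two_mul_le (gapDrop_layer_nonneg hd hW hX₀ m) one_pos
    unfold layerGain
    linarith
  rw [Finset.sum_add_distrib, ← Finset.mul_sum] at h1
  simp only [Finset.sum_const, Finset.card_range, nsmul_eq_mul, mul_one, Nat.cast_add,
    Nat.cast_one] at h1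
  have h2 := sum_gapDrop_le hd hW hX₀ (L + 1)
  have h3 : (0 : ℝ) ≤ L := L.cast_nonneg
  unfold logGradBound
  linarith

/-- The amplification factor of one layer satisfies the hypothesis of `slopeLE_rep`. -/
theorem norm_rep_sq_div_le {d : ℕ} (hd : 0 < d) {W : ℕ → Mat d}
    (hW : ∀ k, W k ∈ Matrix.unitaryGroup (Fin d) ℝ) {X₀ : Mat d} (hX₀ : X₀.det ≠ 0) (k : ℕ)
    (i : Fin d) :
    ‖rep W X₀ k‖ ^ 2 / d ≤
      Real.exp (layerGain W X₀ k / 2) ^ 2 * ∑ j, (W k * rep W X₀ k) i j ^ 2 := by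
  rw [← norm_orthogonal_mul (hW k) (rep W X₀ k)]
  exact norm_sq_div_le hd (det_orthogonal_mul_ne_zero (hW k) (det_rep_ne_zero hW hX₀ k)) i

theorem rep_ne_zero {d : ℕ} (hd : 0 < d) {W : ℕ → Mat d}
    (hW : ∀ k, W k ∈ Matrix.unitaryGroup (Fin d) ℝ) {X₀ : Mat d} (hX₀ : X₀.det ≠ 0) (k : ℕ) :
    rep W X₀ k ≠ 0 :=
  norm_pos_iff.1 (norm_pos_of_det_ne_zero hd (det_rep_ne_zero hW hX₀ k))

theorem mul_sqrt_mul_prod_le_exp {d : ℕ} (hd : 0 < d) (K : ℝ≥0) {W : ℕ → Mat d}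
    (hW : ∀ k, W k ∈ Matrix.unitaryGroup (Fin d) ℝ) {X₀ : Mat d} (hX₀ : X₀.det ≠ 0) {ℓ n L : ℕ}
    (hn : n ≤ L + 1) :
    K * (√d * ∏ k ∈ Finset.Ico ℓ n, Real.exp (layerGain W X₀ k / 2)) ≤
      Real.exp (logGradBound K W X₀ L) := by
  have hK : (K : ℝ) ≤ Real.exp K := by linarith [Real.add_one_le_exp (K : ℝ)]
  have hdd : √(d : ℝ) ≤ Real.exp d := by
    have h1 : (1 : ℝ) ≤ d := by exact_mod_cast hd
    have h2 : √(d : ℝ) ≤ d := Real.sqrt_le_iff.2 ⟨by linarith, by nlinarith⟩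
    linarith [Real.add_one_le_exp (d : ℝ)]
  have hsum : ∑ k ∈ Finset.Ico ℓ n, layerGain W X₀ k / 2 ≤
      (∑ m ∈ Finset.range (L + 1), layerGain W X₀ m) / 2 := by
    rw [Finset.sum_div]
    refine Finset.sum_le_sum_of_subset_of_nonneg (fun k hk => ?_) fun m _ _ =>
      div_nonneg (layerGain_nonneg hd hW hX₀ m) zero_le_two
    rw [Finset.mem_Ico] at hk
    exact Finset.mem_range.2 (by omega)
  rw [← Real.exp_sum, logGradBound, Real.exp_add, Real.exp_add, mul_assoc]
  gcongr

section Loss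

variable {d : ℕ} {K : ℝ≥0} {W : ℕ → Mat d} {X₀ : Mat d} {loss : Mat d → ℝ}

theorem norm_weightGrad_le_of_slopeLE (hd : 0 < d)
    (hW : ∀ k, W k ∈ Matrix.unitaryGroup (Fin d) ℝ) (hX₀ : X₀.det ≠ 0)
    (hloss : LipschitzWith K loss) {Φ : (ℕ → Mat d) → Mat d} {ℓ n L : ℕ} (hn : n ≤ L + 1)
    (hs : SlopeLE (fun A => Φ (Function.update W ℓ A)) (W ℓ)
      (√d * ∏ k ∈ Finset.Ico ℓ n, Real.exp (layerGain W X₀ k / 2)))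
    (hdiff : DifferentiableAt ℝ (fun A => Φ (Function.update W ℓ A)) (W ℓ)) :
    ‖weightGrad (fun V => loss (Φ V)) W ℓ‖ ≤ Real.exp (logGradBound K W X₀ L) := by
  have h := SlopeLE.comp K.2 (slopeLE_of_lipschitzWith hloss _) hs hdiff.continuousAt
  have hc : 0 ≤ (K : ℝ) * (√d * ∏ k ∈ Finset.Ico ℓ n, Real.exp (layerGain W X₀ k / 2)) := by
    positivity
  exact (norm_of_fderiv_single_le (f := inWeight (fun V => loss (Φ V)) W ℓ) hc h).trans
    (mul_sqrt_mul_prod_le_exp hd K hW hX₀ hn)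

theorem slopeLE_rep_exp (hd : 0 < d) (hW : ∀ k, W k ∈ Matrix.unitaryGroup (Fin d) ℝ)
    (hX₀ : X₀.det ≠ 0) {ℓ n : ℕ} (hn : ℓ < n) :
    SlopeLE (fun A => rep (Function.update W ℓ A) X₀ n) (W ℓ)
        (√d * ∏ k ∈ Finset.Ico ℓ n, Real.exp (layerGain W X₀ k / 2)) ∧
      DifferentiableAt ℝ (fun A => rep (Function.update W ℓ A) X₀ n) (W ℓ) :=
  slopeLE_rep (c := fun k => Real.exp (layerGain W X₀ k / 2)) hd hW (fun _ => Real.exp_pos _)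
    (rep_ne_zero hd hW hX₀) (norm_rep_sq_div_le hd hW hX₀) ℓ n hn

theorem slopeLE_logits_exp (hd : 0 < d) (hW : ∀ k, W k ∈ Matrix.unitaryGroup (Fin d) ℝ)
    (hX₀ : X₀.det ≠ 0) {ℓ L : ℕ} (hℓ : ℓ ≤ L) (hL : 1 ≤ L) :
    SlopeLE (fun A => logits (Function.update W ℓ A) X₀ L) (W ℓ)
        (√d * ∏ k ∈ Finset.Ico ℓ L, Real.exp (layerGain W X₀ k / 2)) ∧
      DifferentiableAt ℝ (fun A => logits (Function.update W ℓ A) X₀ L) (W ℓ) :=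
  slopeLE_logits (c := fun k => Real.exp (layerGain W X₀ k / 2)) hd hW (fun _ => Real.exp_pos _)
    (rep_ne_zero hd hW hX₀)
    (fun k => norm_bn_sq (row_sq_pos
      (det_orthogonal_mul_ne_zero (hW k) (det_rep_ne_zero hW hX₀ k))))
    (norm_rep_sq_div_le hd hW hX₀) ℓ L hℓ hL

theorem differentiableAt_inWeight {Φ : (ℕ → Mat d) → Mat d} {ℓ : ℕ}
    (hl : DifferentiableAt ℝ loss (Φ W))
    (hdiff : DifferentiableAt ℝ (fun A => Φ (Function.update W ℓ A)) (W ℓ)) :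
    DifferentiableAt ℝ (inWeight (fun V => loss (Φ V)) W ℓ) (W ℓ) := by
  refine DifferentiableAt.comp (g := loss) (W ℓ) ?_ hdiff
  rwa [Function.update_eq_self]

end Loss

/-! ### Expectations -/

/-- As the bound `B` is nonnegative, it suffices to estimate the positive part of the logarithm. -/
theorem expLogGradLE_of_le {d : ℕ} {Ω : Type*} [MeasurableSpace Ω] {P : Measure Ω}
    {W : ℕ → Ω → Orth d} {F : (ℕ → Mat d) → ℝ} {ℓ : ℕ} {S : Ω → ℝ} {B : ℝ}
    (hgrad : ∀ ω, ‖weightGrad F (fun k => (W k ω : Mat d)) ℓ‖ ≤ Real.exp (S ω)) (hB : 0 ≤ B)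
    (hint : ∫⁻ ω, ENNReal.ofReal (S ω) ∂P ≤ ENNReal.ofReal B) : ExpLogGradLE P W F ℓ B := by
  have hpt : ∀ ω, (ENNReal.log ‖weightGrad F (fun k => (W k ω : Mat d)) ℓ‖ₑ).toENNReal ≤
      ENNReal.ofReal (S ω) := by
    intro ω
    rw [← EReal.real_coe_toENNReal]
    refine EReal.toENNReal_le_toENNReal ?_
    rw [← Real.log_exp (S ω), ← ENNReal.log_ofReal_of_pos (Real.exp_pos _), ← ofReal_norm]
    exact ENNReal.log_le_log (ENNReal.ofReal_le_ofReal (hgrad ω))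
  have hle := (lintegral_mono hpt).trans hint
  refine ⟨hle.trans_lt ENNReal.ofReal_lt_top, ?_⟩
  unfold extExp
  calc _ ≤ ((∫⁻ ω, (ENNReal.log ‖weightGrad F (fun k => (W k ω : Mat d)) ℓ‖ₑ).toENNReal ∂P :
          ℝ≥0∞) : EReal) - 0 := EReal.sub_le_sub le_rfl (EReal.coe_ennreal_nonneg _)
    _ ≤ ((ENNReal.ofReal B : ℝ≥0∞) : EReal) := by
        rw [sub_zero]; exact EReal.coe_ennreal_le_coe_ennreal_iff.2 hle
    _ = (B : EReal) := by rw [EReal.coe_ennreal_ofReal, max_eq_left hB]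

theorem lintegral_logGradBound_le {d : ℕ} (hd : 0 < d) (K : ℝ≥0) {X₀ : Mat d}
    (hX₀ : X₀.det ≠ 0) {Ω : Type*} [MeasurableSpace Ω] {P : Measure Ω} [IsProbabilityMeasure P]
    {W : ℕ → Ω → Orth d} (hlaw : ∀ k, HasLaw (W k) (haarOrth d) P) (hindep : iIndepFun W P)
    (L : ℕ) :
    ∫⁻ ω, ENNReal.ofReal (logGradBound K (fun k => (W k ω : Mat d)) X₀ L) ∂P ≤
      ENNReal.ofReal (K + d + d * isoGap X₀ + lyapunov d (isoGap X₀)) := by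
  have hφ := isoGap_nonneg hd hX₀
  have hV := lyapunov_nonneg d hφ
  have hpt : ∀ ω, ENNReal.ofReal (logGradBound K (fun k => (W k ω : Mat d)) X₀ L) ≤
      ENNReal.ofReal (K + d + d * isoGap X₀) + ∑ m ∈ Finset.range (L + 1), ENNReal.ofReal
        √(2 * gapDrop ((W m ω : Mat d) * rep (fun k => (W k ω : Mat d)) X₀ m)) := by
    intro ω
    have hW : ∀ k, (W k ω : Mat d) ∈ Matrix.unitaryGroup (Fin d) ℝ := fun k => (W k ω).2
    have h1 := sum_gapDrop_le hd hW hX₀ (L + 1)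
    have h2 : 0 ≤ ∑ m ∈ Finset.range (L + 1),
        √(2 * gapDrop ((W m ω : Mat d) * rep (fun k => (W k ω : Mat d)) X₀ m)) :=
      Finset.sum_nonneg fun m _ => Real.sqrt_nonneg _
    have h3 : 0 ≤ d * isoGap X₀ := by positivity
    rw [← ENNReal.ofReal_sum_of_nonneg fun m _ => Real.sqrt_nonneg _,
      ← ENNReal.ofReal_add (by positivity) h2]
    refine ENNReal.ofReal_le_ofReal ?_
    unfold logGradBound layerGain
    rw [Finset.sum_add_distrib]
    linarith
  refine (lintegral_mono hpt).trans ?_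
  have hm : ∀ m, AEMeasurable (fun ω => ENNReal.ofReal
      √(2 * gapDrop ((W m ω : Mat d) * rep (fun k => (W k ω : Mat d)) X₀ m))) P := fun m => by
    have := aemeasurable_gapDrop_layer (X₀ := X₀) (fun k => (hlaw k).aemeasurable) m
    fun_prop
  rw [lintegral_add_left measurable_const, lintegral_finsetSum' _ fun m _ => hm m,
    ENNReal.ofReal_add (by positivity) hV]
  refine add_le_add ?_ (sum_lintegral_sqrt_gapDrop_le hd hX₀ hlaw hindep (L + 1))
  simp

theorem lintegral_logGradBound_le_depth {d : ℕ} (hd : 0 < d) (K : ℝ≥0) {X₀ : Mat d}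
    (hX₀ : X₀.det ≠ 0) {Ω : Type*} [MeasurableSpace Ω] (P : Measure Ω) [IsProbabilityMeasure P]
    (W : ℕ → Ω → Orth d) (L : ℕ) :
    ∫⁻ ω, ENNReal.ofReal (logGradBound K (fun k => (W k ω : Mat d)) X₀ L) ∂P ≤
      ENNReal.ofReal (K + d + d * isoGap X₀ + (L + 1)) := by
  refine (lintegral_mono fun ω => ENNReal.ofReal_le_ofReal
    (logGradBound_le hd K (fun k => (W k ω).2) hX₀ L)).trans ?_
  simp

/-! ### Comparison of the bounds -/

theorem const_bound_le {d : ℕ} (hd : 0 < d) (K : ℝ≥0) {φ : ℝ} (hφ : 0 ≤ φ) :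
    K + d + d * φ + lyapunov d φ ≤ 64 * (K + 1) * d ^ 5 * (φ ^ 3 + 1) := by
  have hd' : (1 : ℝ) ≤ d := by exact_mod_cast hd
  have h1 : (d : ℝ) ≤ d ^ 5 := le_self_pow₀ hd' (by norm_num)
  have h2 : (d : ℝ) ^ 2 ≤ d ^ 5 := pow_le_pow_right₀ hd' (by norm_num)
  have h3 : (1 : ℝ) ≤ d ^ 5 := one_le_pow₀ hd'
  have h4 : φ ≤ φ ^ 3 * (1 / 3) + 2 / 3 := by
    nlinarith [sq_nonneg (φ - 1), mul_nonneg hφ (sq_nonneg (φ - 1))]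
  have h5 : √φ ≤ φ / 2 + 1 / 2 :=
    Real.sqrt_le_iff.2 ⟨by linarith, by nlinarith [sq_nonneg (φ - 1)]⟩
  have hφ3 : 0 ≤ φ ^ 3 := by positivity
  have hK : (0 : ℝ) ≤ K := K.2
  have h6 : K + d + d * φ ≤ (K + 1 + φ) * d ^ 5 := by nlinarith
  have h7 : lyapunov d φ ≤ 18 * (3 / 2 * φ + 1 / 2) * d ^ 5 := by
    have : √φ + φ ≤ 3 / 2 * φ + 1 / 2 := by linarith
    unfold lyapunov
    calc 18 * (d : ℝ) ^ 2 * (√φ + φ) ≤ 18 * d ^ 5 * (3 / 2 * φ + 1 / 2) := by gcongr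
      _ = _ := by ring
  have h8 : (K + 1 + φ) + 18 * (3 / 2 * φ + 1 / 2) ≤ 64 * (K + 1) * (φ ^ 3 + 1) := by
    nlinarith [mul_nonneg hK hφ3]
  calc K + d + d * φ + lyapunov d φ
      ≤ ((K + 1 + φ) + 18 * (3 / 2 * φ + 1 / 2)) * d ^ 5 := by linarith
    _ ≤ 64 * (K + 1) * (φ ^ 3 + 1) * d ^ 5 := by gcongr
    _ = _ := by ring

/-- For `L ≥ 32 d⁴` the exponential is at most `1 / 2` and the bound independent of the depth is
good enough; for smaller `L` it is the sure bound. -/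
theorem depth_bound_le {d : ℕ} (hd : 0 < d) (K : ℝ≥0) {φ : ℝ} (hφ : 0 ≤ φ) {L : ℕ} (hL : 1 ≤ L) :
    K + d + d * φ + lyapunov d φ ≤
        256 * (K + 1) * d ^ 5 * (φ ^ 3 + 1 - Real.exp (-(L : ℝ) / (32 * (d : ℝ) ^ 4))) ∨
      K + d + d * φ + (L + 1) ≤
        256 * (K + 1) * d ^ 5 * (φ ^ 3 + 1 - Real.exp (-(L : ℝ) / (32 * (d : ℝ) ^ 4))) := by
  have hd' : (1 : ℝ) ≤ d := by exact_mod_cast hd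
  have hL' : (1 : ℝ) ≤ L := by exact_mod_cast hL
  have hK : (0 : ℝ) ≤ K := K.2
  have hφ3 : 0 ≤ φ ^ 3 := by positivity
  set x := (L : ℝ) / (32 * (d : ℝ) ^ 4) with hx
  have hx0 : 0 ≤ x := by positivity
  have hexp : Real.exp (-x) ≤ 1 / (1 + x) := by
    rw [Real.exp_neg, ← one_div]
    gcongr
    linarith [Real.add_one_le_exp x]
  rw [neg_div, ← hx]
  rcases le_total 1 x with h1 | h1
  · left
    refine (const_bound_le hd K hφ).trans ?_
    have h2 : 1 / (1 + x) ≤ 1 / 2 := by gcongr; linarith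
    calc 64 * (K + 1) * (d : ℝ) ^ 5 * (φ ^ 3 + 1)
        ≤ 64 * (K + 1) * (d : ℝ) ^ 5 * (4 * (φ ^ 3 + 1 - Real.exp (-x))) := by
          gcongr; linarith
      _ = _ := by ring
  · right
    have h2 : x / 2 ≤ 1 - Real.exp (-x) := by
      have h3 : x / 2 ≤ 1 - 1 / (1 + x) := by
        have : 1 - 1 / (1 + x) = x / (1 + x) := by field_simp; ring
        rw [this]
        gcongr
        linarith
      linarith
    have h4 : (d : ℝ) ^ 5 * (x / 2) = d * L / 64 := by
      rw [hx]; field_simp; norm_num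
    have h5 : φ ≤ φ ^ 3 + 1 := by
      nlinarith [sq_nonneg (φ - 1), mul_nonneg hφ (sq_nonneg (φ - 1))]
    have h6 : (d : ℝ) ≤ d ^ 5 := le_self_pow₀ hd' (by norm_num)
    have hdL : (d : ℝ) ≤ d * L := by nlinarith
    have hLdL : (L : ℝ) ≤ d * L := by nlinarith
    have hone : 1 ≤ (d : ℝ) * L := hd'.trans hdL
    calc K + d + d * φ + (L + 1) ≤ K + d + d * (φ ^ 3 + 1) + (L + 1) := by gcongr
      _ ≤ d ^ 5 * φ ^ 3 + 4 * (K + 1) * (d * L) := by nlinarith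
      _ ≤ 256 * (K + 1) * (d ^ 5 * φ ^ 3) + 4 * (K + 1) * (d * L) := by
          have h7 : 0 ≤ (d : ℝ) ^ 5 * φ ^ 3 := by positivity
          have h8 := le_mul_of_one_le_left h7 (by linarith : 1 ≤ 256 * ((K : ℝ) + 1))
          linarith
      _ = 256 * (K + 1) * d ^ 5 * (φ ^ 3 + x / 2) := by
          rw [mul_assoc (256 * ((K : ℝ) + 1)) _ (φ ^ 3 + x / 2), mul_add ((d : ℝ) ^ 5), h4]; ring
      _ ≤ _ := by
          gcongr
          linarith

theorem expLogGradLE_of_logGradBound {d : ℕ} (hd : 0 < d) (K : ℝ≥0) {X₀ : Mat d}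
    (hX₀ : X₀.det ≠ 0) {Ω : Type*} [MeasurableSpace Ω] {P : Measure Ω} [IsProbabilityMeasure P]
    {W : ℕ → Ω → Orth d} (hlaw : ∀ k, HasLaw (W k) (haarOrth d) P) (hindep : iIndepFun W P)
    {F : (ℕ → Mat d) → ℝ} {ℓ L : ℕ}
    (hgrad : ∀ ω, ‖weightGrad F (fun k => (W k ω : Mat d)) ℓ‖ ≤
      Real.exp (logGradBound K (fun k => (W k ω : Mat d)) X₀ L)) :
    ExpLogGradLE P W F ℓ (256 * (K + 1) * (d : ℝ) ^ 5 * (isoGap X₀ ^ 3 + 1)) ∧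
      (1 ≤ L → ExpLogGradLE P W F ℓ (256 * (K + 1) * (d : ℝ) ^ 5 *
        (isoGap X₀ ^ 3 + 1 - Real.exp (-(L : ℝ) / (32 * (d : ℝ) ^ 4))))) := by
  have hφ := isoGap_nonneg hd hX₀
  have hV := lyapunov_nonneg d hφ
  have hconst := lintegral_logGradBound_le hd K hX₀ hlaw hindep L
  refine ⟨?_, fun hL => ?_⟩
  · refine expLogGradLE_of_le hgrad (by positivity)
      (hconst.trans (ENNReal.ofReal_le_ofReal ((const_bound_le hd K hφ).trans ?_)))
    gcongr
    norm_num
  · rcases depth_bound_le hd K hφ hL with h | h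
    · exact expLogGradLE_of_le hgrad (le_trans (by positivity) h)
        (hconst.trans (ENNReal.ofReal_le_ofReal h))
    · exact expLogGradLE_of_le hgrad (le_trans (by positivity) h)
        ((lintegral_logGradBound_le_depth hd K hX₀ P W L).trans (ENNReal.ofReal_le_ofReal h))

end OrthoBN

theorem mainTheorem1 (K : ℝ≥0) :
    ∃ C : ℝ, ∀ (d : ℕ) (_hd : 0 < d) (X₀ : OrthoBN.Mat d) (_hX₀ : X₀.det ≠ 0)
      (loss : OrthoBN.Mat d → ℝ) (_hloss : LipschitzWith K loss)
      (Ω : Type*) [MeasurableSpace Ω] (P : Measure Ω) [IsProbabilityMeasure P]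
      (W : ℕ → Ω → OrthoBN.Orth d)
      (_hlaw : ∀ k, HasLaw (W k) (OrthoBN.haarOrth d) P) (_hindep : iIndepFun W P)
      (L ℓ : ℕ) (_hℓ : ℓ ≤ L),
      -- the loss is evaluated at the network output `X_(L+1)`
      ((∀ᵐ ω ∂P,
          DifferentiableAt ℝ loss (OrthoBN.rep (fun k => (W k ω : OrthoBN.Mat d)) X₀ (L + 1)) →
          DifferentiableAt ℝ
            (OrthoBN.inWeight (fun V => loss (OrthoBN.rep V X₀ (L + 1)))
              (fun k => (W k ω : OrthoBN.Mat d)) ℓ)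
            (W ℓ ω : OrthoBN.Mat d)) ∧
        OrthoBN.ExpLogGradLE P W (fun V => loss (OrthoBN.rep V X₀ (L + 1))) ℓ
          (C * (d : ℝ) ^ 5 * (OrthoBN.isoGap X₀ ^ 3 + 1)) ∧
        (1 ≤ L →
          OrthoBN.ExpLogGradLE P W (fun V => loss (OrthoBN.rep V X₀ (L + 1))) ℓ
            (C * (d : ℝ) ^ 5 *
              (OrthoBN.isoGap X₀ ^ 3 + 1 - Real.exp (-(L : ℝ) / (32 * (d : ℝ) ^ 4)))))) ∧
      -- the loss is evaluated at the logits `W_L X_L`, behind at least one normalised layer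
      (1 ≤ L →
        (∀ᵐ ω ∂P,
          DifferentiableAt ℝ loss (OrthoBN.logits (fun k => (W k ω : OrthoBN.Mat d)) X₀ L) →
          DifferentiableAt ℝ
            (OrthoBN.inWeight (fun V => loss (OrthoBN.logits V X₀ L))
              (fun k => (W k ω : OrthoBN.Mat d)) ℓ)
            (W ℓ ω : OrthoBN.Mat d)) ∧
        OrthoBN.ExpLogGradLE P W (fun V => loss (OrthoBN.logits V X₀ L)) ℓ
          (C * (d : ℝ) ^ 5 * (OrthoBN.isoGap X₀ ^ 3 + 1)) ∧
          OrthoBN.ExpLogGradLE P W (fun V => loss (OrthoBN.logits V X₀ L)) ℓ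
            (C * (d : ℝ) ^ 5 *
              (OrthoBN.isoGap X₀ ^ 3 + 1 - Real.exp (-(L : ℝ) / (32 * (d : ℝ) ^ 4))))) := by
  refine ⟨256 * (K + 1), fun d hd X₀ hX₀ loss hloss Ω _ P _ W hlaw hindep L ℓ hℓ => ?_⟩
  have hW : ∀ ω k, (W k ω : OrthoBN.Mat d) ∈ Matrix.unitaryGroup (Fin d) ℝ := fun ω k => (W k ω).2
  refine ⟨⟨ae_of_all _ fun ω hl => ?_, ?_⟩, fun hL => ⟨ae_of_all _ fun ω hl => ?_, ?_⟩⟩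
  · exact OrthoBN.differentiableAt_inWeight hl
      (OrthoBN.slopeLE_rep_exp hd (hW ω) hX₀ (Nat.lt_succ_of_le hℓ)).2
  · refine OrthoBN.expLogGradLE_of_logGradBound hd K hX₀ hlaw hindep fun ω => ?_
    obtain ⟨h1, h2⟩ := OrthoBN.slopeLE_rep_exp hd (hW ω) hX₀ (Nat.lt_succ_of_le hℓ)
    exact OrthoBN.norm_weightGrad_le_of_slopeLE hd (hW ω) hX₀ hloss le_rfl h1 h2
  · exact OrthoBN.differentiableAt_inWeight hl
      (OrthoBN.slopeLE_logits_exp hd (hW ω) hX₀ hℓ hL).2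
  · have h : ∀ ω, ‖OrthoBN.weightGrad (fun V => loss (OrthoBN.logits V X₀ L))
        (fun k => (W k ω : OrthoBN.Mat d)) ℓ‖ ≤
        Real.exp (OrthoBN.logGradBound K (fun k => (W k ω : OrthoBN.Mat d)) X₀ L) := fun ω => by
      obtain ⟨h1, h2⟩ := OrthoBN.slopeLE_logits_exp hd (hW ω) hX₀ hℓ hL
      exact OrthoBN.norm_weightGrad_le_of_slopeLE hd (hW ω) hX₀ hloss L.le_succ h1 h2
    obtain ⟨h3, h4⟩ := OrthoBN.expLogGradLE_of_logGradBound hd K hX₀ hlaw hindep h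
    exact ⟨h3, h4 hL⟩
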